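/- Notation. Let $W_n=\{x\in\mathbb Z^n: x_1<\dots<x_n\}$, and for $x\in W_n$, $y\in W_{n+1}$ write $x\prec y$ if $y_1<x_1\le y_2<x_2\le\dots<x_n\le y_{n+1}$. Let $GT_N$ be the set of $(x^1,\dots,x^N)$ with $x^n\in W_n$ and $x^n\prec x^{n+1}$. The continuous-time interlacing (Charlier) dynamics on $GT_N$ is the following Markov chain: the particles $x_k^n$, $1\le k\le n\le N$, have independent exponential clocks of rate $1$; when the clock of $x_k^n$ rings, it jumps to the right by one, unless $k\le n-1$ and $x_k^n+1=x_k^{n-1}$, in which case it is blocked and nothing happens; if it jumps and $x_{k+1}^{n+1}=x_k^n$ before the jump, then $x_{k+1}^{n+1}$ is pushed to the right by one at the same moment, and pushes $x_{k+2}^{n+2}$ in the same way if that one is at the same site, and so on. Consider this process started from the packed initial condition $x_k^n(0)=-n-1+k$, $1\le k\le n\le N$. For levels $n\ge1$ and times $t\geq 0$ write $(n,t)\prec(n',t')$ if $n\ge n'$, $t\le t'$ and $(n,t)\ne(n',t')$. Let $m\ge1$ and let $(n_1,t_1)\prec(n_2,t_2)\prec\dots\prec(n_m,t_m)$ be space-like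 points with $1\le n_m$, $n_1\le N$ and $t_1>0$. For $0\le n\le n_1$ let $c(n)=\#\{i: n_i=n\}$, let $t_1^n<\dots<t_{c(n)}^n$ be the times $t_i$ with $n_i=n$, and put $t_0^{n_1}=t_1$ and $t_0^n=t_{c(n+1)}^{n+1}$ for $n<n_1$, so that $t_0^n\le t_1^n<\dots<t_{c(n)}^n$. For $t\ge0$ and $x\in\mathbb Z$ put $\omega_t(x)=e^{-t}t^x/x!$ if $x\ge0$ and $\omega_t(x)=0$ if $x<0$ (with $0^0=1$), and for $x,y\in\mathbb Z$ put $p_t(x,y)=\omega_t(y-x)$ (so $p_0(x,y)=\mathbf 1_{x=y}$) and $\phi(x,y)=\mathbf 1_{y\ge x}$. Set $\phi(x_n^{n-1}(\cdot),y)=1$ for the virtual variables $x_n^{n-1}$, and $\Delta_n(x)=\prod_{1\le i<j\le n}(x_j-x_i)$. Proposition. There is a normalizing constant $\mathrm{const}$, depending only on the points $(n_i,t_i)$, such that $$ \mathrm{const}\,\prod_{n=1}^{n_1}\bigg[\det\big[\phi(x_i^{n-1}(t_0^{n-1}),x_j^n(t_{c(n)}^n))\big]_{i,j=1}^n\ \prod_{a=1}^{c(n)}\det\big[p_{t_a^n-t_{a-1}^n}(x_i^n(t_{a-1}^n),x_j^n(t_a^n))\big]_{i,j=1}^n\bigg]\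 \Delta_{n_1}\big(x^{n_1}(t_0^{n_1})\big)\prod_{i=1}^{n_1}\omega_{t_1}\big(x_i^{n_1}(t_0^{n_1})+n_1\big) $$ is a probability measure on the set of families $(x^n(t_a^n))_{1\le n\le n_1,\,0\le a\le c(n)}$ with $x^n(t_a^n)\in W_n$ (one variable for each pair $(n,a)$, also where two of the times coincide), and the joint distribution of $$(x^{n_1}(t_1),\dots,x^{n_m}(t_m))$$ is its marginal on the variables $x^{n}(t_a^{n})$, $1\le a\le c(n)$, that correspond to the observed points. -/

import Mathlib

open MeasureTheory
open scoped NNReal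

noncomputable section

namespace GTDynamics

/-! ### Interlacing configurations -/

/-- The Weyl chamber `W_n = {x ∈ ℤⁿ : x_1 < x_2 < ⋯ < x_n}`. -/
def Weyl (n : ℕ) : Type := {x : Fin n → ℤ // StrictMono x}

instance (n : ℕ) : CoeFun (Weyl n) (fun _ => Fin n → ℤ) := ⟨Subtype.val⟩

/-- Interlacing `x ≺ y` of a level with `n` particles and one with `n + 1` particles:
`y_1 < x_1 ≤ y_2 < x_2 ≤ ⋯ < x_n ≤ y_{n+1}`. -/
def Interlaces {n : ℕ} (x : Fin n → ℤ) (y : Fin (n + 1) → ℤ) : Prop :=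
  ∀ k : Fin n, y k.castSucc < x k ∧ x k ≤ y k.succ

/-- Triangular arrays of integers with levels `0, 1, …, N`; level `n` has `n` entries (so that
level `0` is void).  Entry `k : Fin n` of level `n` is `x_{k+1}^n`. -/
abbrev Arr (N : ℕ) : Type := (n : Fin (N + 1)) → Fin (n : ℕ) → ℤ

/-- A triangular array is a Gelfand-Tsetlin pattern if `x^n ∈ W_n` for all `n` and
`x^n ≺ x^{n+1}` for all `n < N`. -/
def IsGT {N : ℕ} (x : Arr N) : Prop :=
  (∀ n, StrictMono (x n)) ∧
    ∀ n : Fin N, Interlaces (n := (n : ℕ)) (x n.castSucc) (x n.succ)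

/-- The state space `GT_N` of interlacing configurations with `N` levels. -/
def GT (N : ℕ) : Type := {x : Arr N // IsGT x}

/-- The level `x^n ∈ W_n` of a pattern in `GT_N`, for `n ≤ N`. -/
def GT.level {N : ℕ} (x : GT N) (n : ℕ) (hn : n ≤ N) : Weyl n :=
  ⟨x.1 ⟨n, Nat.lt_succ_of_le hn⟩, x.2.1 ⟨n, Nat.lt_succ_of_le hn⟩⟩

/-- The packed configuration `x_k^n = -n - 1 + k`, `1 ≤ k ≤ n ≤ N` (with `k` shifted by one). -/
def packed (N : ℕ) : GT N :=
  ⟨fun n k => -(n : ℤ) - 1 + ((k : ℕ) + 1 : ℤ), by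
    refine ⟨fun n i j hij => ?_, fun n k => ?_⟩
    · have : (i : ℕ) < (j : ℕ) := hij
      simp only
      omega
    · simp only [Fin.val_castSucc, Fin.val_succ]
      constructor <;> push_cast <;> omega⟩

/-! ### The dynamics with blocking and pushing -/

/-- The particles `x_k^n`, `1 ≤ k ≤ n ≤ N`, of an array; each one carries its own clock. -/
abbrev Particle (N : ℕ) : Type := (n : Fin (N + 1)) × Fin (n : ℕ)

/-- `x_k^n` is blocked if its jump by one to the right would lead to `x_k^n = x_k^{n-1}`
(where `x_k^{n-1}` exists iff `k ≤ n - 1`). -/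
def Blocked {N : ℕ} (x : Arr N) (p : Particle N) : Prop :=
  ∃ (l : Fin (N + 1)) (j : Fin (l : ℕ)),
    (l : ℕ) + 1 = (p.1 : ℕ) ∧ (j : ℕ) = (p.2 : ℕ) ∧ x p.1 p.2 + 1 = x l j

/-- Particle `q` moves together with `p = x_k^n` if `q` is one of the particles
`x_k^n, x_{k+1}^{n+1}, x_{k+2}^{n+2}, …` and sits at the same site as `p`: in a pattern
`x_k^n ≤ x_{k+1}^{n+1} ≤ ⋯`, and a jump of `p` pushes `x_{k+1}^{n+1}` if they are at the same
site, which in turn pushes `x_{k+2}^{n+2}` if they are at the same site, and so on. -/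
def Carried {N : ℕ} (x : Arr N) (p q : Particle N) : Prop :=
  (p.1 : ℕ) ≤ (q.1 : ℕ) ∧ (q.2 : ℕ) + (p.1 : ℕ) = (p.2 : ℕ) + (q.1 : ℕ) ∧
    x q.1 q.2 = x p.1 p.2

open Classical in
/-- The array after the clock of particle `p` has rung: nothing happens if `p` is blocked,
otherwise `p` and the particles it pushes move to the right by one. -/
def ringArr {N : ℕ} (p : Particle N) (x : Arr N) : Arr N := fun n k =>
  if ¬ Blocked x p ∧ Carried x p ⟨n, k⟩ then x n k + 1 else x n k

theorem isGT_ringArr {N : ℕ} (p : Particle N) {x : Arr N} (hx : IsGT x) :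
    IsGT (ringArr p x) := by
  classical
  by_cases hb : Blocked x p
  · have : ringArr p x = x := by
      funext n k
      simp [ringArr, hb]
    rwa [this]
  -- the array as a function of two natural numbers
  set F : ℕ → ℕ → ℤ := fun n i =>
    if h : n < N + 1 ∧ i < n then x ⟨n, h.1⟩ ⟨i, h.2⟩ else 0 with hF
  have F_eq : ∀ (n : Fin (N + 1)) (i : Fin (n : ℕ)), x n i = F n i := by
    intro n i
    simp only [hF]
    rw [dif_pos ⟨n.isLt, i.isLt⟩]
  have F_int : ∀ n i, n + 1 < N + 1 → i < n →
      F (n + 1) i < F n i ∧ F n i ≤ F (n + 1) (i + 1) := by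
    intro n i hn hi
    have h := hx.2 ⟨n, by omega⟩ ⟨i, hi⟩
    simp only [hF]
    rw [dif_pos ⟨hn, by omega⟩, dif_pos ⟨by omega, hi⟩, dif_pos ⟨hn, by omega⟩]
    exact h
  obtain ⟨pn, pk⟩ := p
  set v : ℤ := F pn pk with hv
  have hpn := pn.isLt
  have hpk := pk.isLt
  have hnb : ∀ l, l + 1 = (pn : ℕ) → (pk : ℕ) < l → F l pk ≠ v + 1 := by
    intro l hl hk he
    apply hb
    refine ⟨⟨l, by omega⟩, ⟨pk, hk⟩, hl, rfl, ?_⟩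
    rw [F_eq, F_eq]
    exact he.symm
  have chain : ∀ r, (pn : ℕ) + r < N + 1 → v ≤ F (pn + r) (pk + r) := by
    intro r
    induction r with
    | zero => intro _; simp [hv]
    | succ r ih =>
      intro h
      exact (ih (by omega)).trans (F_int (pn + r) (pk + r) (by omega) (by omega)).2
  have gap : ∀ r, (pn : ℕ) + r < N + 1 → F (pn + r) (pk + r) = v → (pk : ℕ) + 1 < pn →
      v + 1 < F (pn + r) (pk + r + 1) := by
    intro r
    induction r with
    | zero =>
      intro _ _ h
      obtain ⟨l, hl⟩ : ∃ l, (pn : ℕ) = l + 1 := ⟨pn - 1, by omega⟩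
      have h1 := hnb l hl.symm (by omega)
      have h2 := F_int l pk (by omega) (by omega)
      rw [← hl] at h2
      simp only [Nat.add_zero]
      omega
    | succ r ih =>
      intro h1 h2 h3
      have h4 := F_int (pn + r) (pk + r) (by omega) (by omega)
      have h5 := chain r (by omega)
      have h6 := ih (by omega) (by rw [← Nat.add_assoc, ← Nat.add_assoc] at h2; omega) h3
      have h7 := F_int (pn + r) (pk + r + 1) (by omega) (by omega)
      have h8 := h7.2
      have e : (pn : ℕ) + (r + 1) = pn + r + 1 := rfl
      have e' : (pk : ℕ) + (r + 1) + 1 = pk + r + 1 + 1 := rfl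
      rw [e, e']
      omega
  have y_eq : ∀ (n : Fin (N + 1)) (i : Fin (n : ℕ)), ringArr ⟨pn, pk⟩ x n i =
      if (pn : ℕ) ≤ n ∧ (i : ℕ) + pn = pk + n ∧ F n i = v then F n i + 1 else F n i := by
    intro n i
    simp only [ringArr, hb, not_false_eq_true, true_and, Carried, F_eq, ← hv]
  have hint : ∀ n : Fin N, Interlaces (n := (n : ℕ)) (ringArr ⟨pn, pk⟩ x n.castSucc)
      (ringArr ⟨pn, pk⟩ x n.succ) := by
    intro n i
    have hn := n.isLt
    have hi : (i : ℕ) < n := i.isLt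
    have h1 := F_int n i (by omega) hi
    refine ⟨?_, ?_⟩
    · rw [y_eq, y_eq]
      simp only [Fin.val_castSucc, Fin.val_succ]
      split_ifs with ha hc hc
      · omega
      · obtain ⟨ha1, ha2, ha3⟩ := ha
        rcases Nat.lt_or_ge (n : ℕ) pn with hlt | hge
        · have e : (n : ℕ) + 1 = pn := by omega
          have e2 : (i : ℕ) = pk := by omega
          have h2 := hnb n e (by omega)
          rw [e2] at h1 ha3 ⊢
          omega
        · obtain ⟨r, hr⟩ := Nat.exists_eq_add_of_le hge
          have e2 : (i : ℕ) = pk + r + 1 := by omega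
          have h2 := chain r (by omega)
          have h3 := F_int (pn + r) (pk + r) (by omega) (by omega)
          have h4 := gap r (by omega)
          rw [e2, hr] at ha3 ⊢
          have h5 := h4 (by omega) (by omega)
          omega
      · omega
      · omega
    · rw [y_eq, y_eq]
      simp only [Fin.val_castSucc, Fin.val_succ]
      split_ifs with ha hc hc
      · omega
      · obtain ⟨ha1, ha2, ha3⟩ := ha
        have : F (n + 1) (i + 1) ≠ v := fun h => hc ⟨by omega, by omega, h⟩
        omega
      · omega
      · omega
  refine ⟨fun n => ?_, hint⟩
  obtain ⟨n, hn⟩ := n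
  rcases n with _ | n
  · exact fun i => i.elim0
  · refine Fin.strictMono_iff_lt_succ.2 fun i => ?_
    have h := hint ⟨n, by omega⟩ i
    exact lt_of_lt_of_le h.1 h.2

/-- The configuration after the clock of particle `p` has rung. -/
def ring {N : ℕ} (p : Particle N) (x : GT N) : GT N :=
  ⟨ringArr p x.1, isGT_ringArr p x.2⟩

open Classical in
/-- The number of words of `r` clock rings that lead from `x` to `y`. -/
def ringCount {N : ℕ} : ℕ → GT N → GT N → ℕ
  | 0, x, y => if x = y then 1 else 0
  | r + 1, x, y => ∑ p : Particle N, ringCount r (ring p x) y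

/-- The transition probability from `x` to `y` in time `t` of the continuous-time Markov chain on
`GT_N` in which all particles have independent clocks ringing at rate `1`.  It is the entry
`(x, y)` of `exp (t L)`, where `(L f)(x) = ∑ p, (f (ring p x) - f x)` is the generator, that is of
`e^{-Rt} exp (t A)`, with `R = N (N + 1) / 2` the number of particles and
`A(x, y) = #{p : ring p x = y}`. -/
def transProb {N : ℕ} (t : ℝ≥0) (x y : GT N) : ℝ :=
  Real.exp (-((Fintype.card (Particle N) : ℝ) * t)) *
    ∑' r : ℕ, (t : ℝ) ^ r / (r.factorial : ℝ) * (ringCount r x y : ℝ)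

/-- `X` is the interlacing dynamics on `GT_N` started from the packed initial condition: a
continuous-time Markov chain with transition probabilities `transProb` and `X(0) = packed`. -/
structure IsPackedDynamics {Ω : Type*} [MeasurableSpace Ω] (μ : Measure Ω) {N : ℕ}
    (X : ℝ≥0 → Ω → GT N) : Prop where
  measurable : ∀ t x, MeasurableSet {ω | X t ω = x}
  initial : ∀ᵐ ω ∂μ, X 0 ω = packed N
  markov : ∀ (r : ℕ) (s : Fin (r + 1) → ℝ≥0), Monotone s → ∀ x : Fin (r + 1) → GT N,
    μ.real {ω | ∀ i, X (s i) ω = x i} =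
      μ.real {ω | X (s 0) ω = x 0} *
        ∏ i : Fin r, transProb (s i.succ - s i.castSucc) (x i.castSucc) (x i.succ)

/-! ### Space-like points -/

/-- `(n, t) ≺ (n', t')` iff `n ≥ n'`, `t ≤ t'` and `(n, t) ≠ (n', t')`. -/
def SpaceLike (a b : ℕ × ℝ≥0) : Prop := b.1 ≤ a.1 ∧ a.2 ≤ b.2 ∧ a ≠ b

theorem SpaceLike.level_le_top {m : ℕ} [NeZero m] {lev : Fin m → ℕ} {tm : Fin m → ℝ≥0}
    (h : ∀ i j, i < j → SpaceLike (lev i, tm i) (lev j, tm j)) (i : Fin m) : lev i ≤ lev 0 := by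
  rcases eq_or_ne i 0 with rfl | hi
  · exact le_rfl
  · exact (h 0 i (Fin.pos_iff_ne_zero.2 hi)).1

/-- `c(n)`, the number of observation points at level `n`. -/
def numAt {m : ℕ} (lev : Fin m → ℕ) (n : ℕ) : ℕ :=
  (Finset.univ.filter fun i => lev i = n).card

/-- The number of observation points at levels higher than `n`. -/
def numAbove {m : ℕ} (lev : Fin m → ℕ) (n : ℕ) : ℕ :=
  (Finset.univ.filter fun i => n < lev i).card

theorem numAbove_add_numAt_le {m : ℕ} (lev : Fin m → ℕ) (n : ℕ) :
    numAbove lev n + numAt lev n ≤ m := by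
  unfold numAbove numAt
  rw [← Finset.card_union_of_disjoint]
  · simpa using Finset.card_le_univ
      ((Finset.univ.filter fun i => n < lev i) ∪ (Finset.univ.filter fun i => lev i = n))
  · rw [Finset.disjoint_filter]
    intro i _ h
    omega

/-- The times `t_0^n ≤ t_1^n < ⋯ < t_{c(n)}^n` of level `n`.  Along space-like points the levels
decrease, hence the points at level `n` come right after the `numAbove lev n` points at higher
levels.  So `t_a^n`, `1 ≤ a ≤ c(n)`, is the `a`-th observation time at level `n`, and `t_0^n` is
the last observation time at the levels higher than `n`, that is `t_0^n = t_{c(n+1)}^{n+1}`; at the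
top level, where there is no such time, it is the first observation time. -/
def levelTime {m : ℕ} [NeZero m] (lev : Fin m → ℕ) (tm : Fin m → ℝ≥0) (n : ℕ)
    (a : Fin (numAt lev n + 1)) : ℝ≥0 :=
  if (a : ℕ) = 0 ∧ numAbove lev n = 0 then tm 0
  else tm ⟨numAbove lev n + (a : ℕ) - 1, by
    have h1 := numAbove_add_numAt_le lev n
    have h2 := a.isLt
    have h3 := NeZero.pos m
    omega⟩

/-- The index `a ∈ {1, …, c(n_i)}` such that the point `(n_i, t_i)` is the `a`-th one at its
level. -/
def rankAt {m : ℕ} (lev : Fin m → ℕ) (i : Fin m) : Fin (numAt lev (lev i) + 1) :=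
  ⟨(Finset.univ.filter fun j => j ≤ i ∧ lev j = lev i).card, by
    refine Nat.lt_succ_of_le (Finset.card_le_card fun j => ?_)
    simp only [Finset.mem_filter, Finset.mem_univ, true_and]
    exact fun h => h.2⟩

/-! ### The product measure -/

/-- `ω_t(x) = e^{-t} t^x / x!`, which is `0` for `x < 0`. -/
def poissonWeight (t : ℝ≥0) (x : ℤ) : ℝ :=
  if 0 ≤ x then Real.exp (-(t : ℝ)) * (t : ℝ) ^ x.toNat / (x.toNat.factorial : ℝ) else 0

/-- The one-particle transition probability `p_t(x, y) = p_t(y - x)` of a Poisson process. -/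
def poissonKernel (t : ℝ≥0) (x y : ℤ) : ℝ := poissonWeight t (y - x)

/-- `φ(x, y) = 1` if `y ≥ x` and `0` otherwise. -/
def phi (x y : ℤ) : ℝ := if x ≤ y then 1 else 0

/-- `det [φ(x_i^{n-1}, x_j^n)]_{i,j=1}^n` for `n = l + 1`, where `x_n^{n-1}` is the virtual
variable, for which `φ(virt, y) = 1`. -/
def phiDet {l : ℕ} (x : Fin l → ℤ) (y : Fin (l + 1) → ℤ) : ℝ :=
  Matrix.det (Matrix.of fun i j : Fin (l + 1) =>
    if h : (i : ℕ) < l then phi (x ⟨i, h⟩) (y j) else 1)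

/-- `det [p_t(x_i, y_j)]_{i,j=1}^n`. -/
def poissonDet {n : ℕ} (t : ℝ≥0) (x y : Fin n → ℤ) : ℝ :=
  Matrix.det (Matrix.of fun i j : Fin n => poissonKernel t (x i) (y j))

/-- The Vandermonde determinant `Δ_n(x) = ∏_{i < j} (x_j - x_i)`. -/
def vandermonde {n : ℕ} (x : Fin n → ℤ) : ℝ :=
  ∏ i : Fin n, ∏ j ∈ Finset.Ioi i, ((x j : ℝ) - (x i : ℝ))

/-- The configurations on which the product measure lives: one `x^n(t_a^n) ∈ W_n` for each level
`n ≤ n_1` and each `0 ≤ a ≤ c(n)`. (At the void level `0` there is only one choice.) -/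
abbrev Config {m : ℕ} [NeZero m] (lev : Fin m → ℕ) : Type :=
  (n : Fin (lev 0 + 1)) → Fin (numAt lev n + 1) → Weyl n

/-- The weight
`∏_{n=1}^{n_1} (det[φ(x_i^{n-1}(t_0^{n-1}), x_j^n(t_{c(n)}^n))]
  × ∏_{a=1}^{c(n)} det[p_{t_a^n - t_{a-1}^n}(x_i^n(t_{a-1}^n), x_j^n(t_a^n))])
  × Δ_{n_1}(x^{n_1}(t_0^{n_1})) ∏_{i=1}^{n_1} ω_{t_1}(x_i^{n_1}(t_0^{n_1}) + n_1)`. -/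
def weight {m : ℕ} [NeZero m] (lev : Fin m → ℕ) (tm : Fin m → ℝ≥0) (z : Config lev) : ℝ :=
  (∏ l : Fin (lev 0),
    (phiDet (l := (l : ℕ)) (z l.castSucc 0) (z l.succ (Fin.last _)) *
      ∏ a : Fin (numAt lev (l.succ : Fin (lev 0 + 1))),
        poissonDet (levelTime lev tm _ a.succ - levelTime lev tm _ a.castSucc)
          (z l.succ a.castSucc) (z l.succ a.succ))) *
  vandermonde (z (Fin.last _) 0) *
  ∏ i : Fin (lev 0), poissonWeight (tm 0) (z (Fin.last _) 0 i + (lev 0 : ℤ))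

/-- The coordinates `(x^{n_1}(t_1), …, x^{n_m}(t_m))` of a configuration. -/
def observed {m : ℕ} [NeZero m] (lev : Fin m → ℕ) (hlev : ∀ i, lev i ≤ lev 0)
    (z : Config lev) (i : Fin m) : Weyl (lev i) :=
  z ⟨lev i, Nat.lt_succ_of_le (hlev i)⟩ (rankAt lev i)

end GTDynamics

end

/-! The proof rests on a property of laws on patterns of height n: the mass of a pattern depends on
its top level only, so that the lower levels are uniform given the top one. `HasLevelLaw` expresses
this for the process at a fixed time, on an event of the past. It holds for the packed start at
every height, because the packed top level admits a single pattern. Three operations preserve it: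
letting time pass, restricting to an event about the top level at the current time, and forgetting
the top level. Space-like points can be visited by moving forward in time on a fixed level and down
the levels at a fixed time. Alternating the operations along them gives the joint law as a product
of Karlin-McGregor determinants (time steps) and interlacing indicators (descents); see
`tsum_config`.

The substance is preservation in time, `levelSum_transProb`: the transition probabilities into z,
summed over the initial patterns with top level a, equal a determinant that sees only the top level
of z. This follows from an intertwining of generators, `sum_levelSum_ring`: summed over patterns
with a given top level, the dynamics becomes, up to an additive constant, that of independent
Poisson particles killed at collisions. By induction on the height it suffices to treat two adjacent
levels (`two_level_intertwining`), where two cancellations occur. Blocked jumps of an upper particle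
supply the lower positions that no jump without pushing reaches, and pushes supply the lower
positions that free jumps of the upper particle miss. The killed paths are counted by j! det[1 /
(b_j - a_i)!] (`killedOp_pow_single`), and summing the exponential series yields the Poisson
determinant.

The weight of the theorem agrees with this product up to a constant: det φ is the indicator of
interlacing up to a sign depending on the level only (`neg_one_pow_mul_phiDet`), and the determinant
started from the packed configuration is a multiple of the Charlier density (`poissonDet_packed`).
Sums are taken in [0, ∞], where they may be interchanged freely, and are turned into real sums at
the end. -/

namespace GTDynamics

open Matrix

/-! ### Determinants -/

/-- The only strictly monotone permutation of `Fin n` is the identity. -/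
theorem perm_eq_one_of_strictMono {n : ℕ} {σ : Equiv.Perm (Fin n)} (h : StrictMono σ) : σ = 1 := by
  ext i
  have := (h.range_inj strictMono_id).1 (by rw [σ.surjective.range_eq, Set.range_id])
  rw [this]
  rfl

/-- A determinant equals the product of the diagonal entries if every non-vanishing term of its
Leibniz expansion comes from a strictly monotone permutation. -/
theorem det_eq_prod_diag {n : ℕ} (M : Matrix (Fin n) (Fin n) ℝ)
    (h : ∀ σ : Equiv.Perm (Fin n), (∀ i, M (σ i) i ≠ 0) → StrictMono σ) :
    M.det = ∏ i, M i i := by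
  rw [Matrix.det_apply', Finset.sum_eq_single 1]
  · simp
  · intro σ _ hσ
    by_contra hne
    apply hσ
    apply perm_eq_one_of_strictMono
    apply h
    intro i hi
    exact hne (mul_eq_zero_of_right _ (Finset.prod_eq_zero (Finset.mem_univ i) hi))
  · simp

open Classical in
/-- Up to a sign, `phiDet` is the indicator function of interlacing. -/
theorem neg_one_pow_mul_phiDet {l : ℕ} {x : Fin l → ℤ} {y : Fin (l + 1) → ℤ} (hx : StrictMono x)
    (hy : StrictMono y) :
    (-1) ^ l * phiDet x y = if Interlaces x y then 1 else 0 := by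
  set M : Matrix (Fin (l + 1)) (Fin (l + 1)) ℝ := Matrix.of fun i j =>
    if h : (i : ℕ) < l then phi (x ⟨i, h⟩) (y j) else 1 with hM
  set D : Matrix (Fin (l + 1)) (Fin (l + 1)) ℝ := Matrix.of fun i j =>
    Fin.cases (M i 0) (fun k => M i k.succ - M i k.castSucc) j with hD
  set E : Matrix (Fin l) (Fin l) ℝ := Matrix.of fun i j =>
    if y j.castSucc < x i ∧ x i ≤ y j.succ then 1 else 0 with hE
  -- Subtracting from each column its predecessor turns the step functions φ(x_i, ·) into indicators
  -- of the half-open intervals between consecutive y's.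
  have h1 : M.det = D.det := by
    refine Matrix.det_eq_of_forall_col_eq_smul_add_pred (fun _ => 1) (fun i => ?_) fun i j => ?_
    · simp [hD]
    · simp [hD]
  -- The last row, of virtual entries 1, has become (1, 0, …, 0). Its corner entry has cofactor sign
  -- (-1)^l.
  have h2 : D.det = (-1) ^ l * E.det := by
    rw [Matrix.det_succ_row D (Fin.last l), Fin.sum_univ_succ, Finset.sum_eq_zero, add_zero]
    · have : D.submatrix (Fin.last l).succAbove (Fin.succAbove 0) = E := by
        ext i j
        have hyj : y j.castSucc < y j.succ := hy Fin.castSucc_lt_succ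
        simp only [hD, hM, hE, Matrix.submatrix_apply, Matrix.of_apply, Fin.succAbove_last,
          Fin.succAbove_zero, Fin.cases_succ, Fin.val_castSucc, Fin.is_lt, dif_pos, phi, Fin.eta]
        split_ifs <;> first | omega | norm_num
      rw [this]
      simp [hD, hM]
    · intro j _
      simp [hD, hM]
  -- The intervals are disjoint and ordered like their indices, and x is increasing, so only an
  -- increasing assignment of entries to intervals survives.
  have h3 : E.det = ∏ i, E i i := by
    refine det_eq_prod_diag E fun σ hσ i j hij => ?_
    have hi := hσ i
    have hj := hσ j
    simp only [hE, Matrix.of_apply, ne_eq, ite_eq_right_iff, one_ne_zero, imp_false,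
      not_not] at hi hj
    rw [← hx.lt_iff_lt]
    have : y i.succ ≤ y j.castSucc := hy.monotone (by
      rw [Fin.le_def]; simp only [Fin.val_succ, Fin.val_castSucc]; exact hij)
    omega
  have h4 : phiDet x y = (-1) ^ l * E.det := by rw [← h2, ← h1]; rfl
  rw [h4, ← mul_assoc, ← mul_pow, neg_one_mul, neg_neg, one_pow, one_mul, h3]
  simp only [hE, Matrix.of_apply, Finset.prod_ite_zero]
  simp only [Interlaces, Finset.mem_univ, true_imp_iff, Finset.prod_const_one]
  congr

/-- `1 / d!`, which is `0` for `d < 0`. -/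
noncomputable def invFact (d : ℤ) : ℝ := if 0 ≤ d then ((d.toNat.factorial : ℝ))⁻¹ else 0

theorem invFact_of_neg {d : ℤ} (h : d < 0) : invFact d = 0 := if_neg (by omega)

theorem invFact_sub_one (d : ℤ) : invFact (d - 1) = d * invFact d := by
  rcases lt_trichotomy d 0 with h | rfl | h
  · rw [invFact_of_neg h, invFact_of_neg (by omega), mul_zero]
  · simp [invFact]
  · obtain ⟨n, rfl⟩ : ∃ n : ℕ, d = n + 1 := ⟨(d - 1).toNat, by omega⟩
    rw [invFact, invFact, if_pos (by omega), if_pos (by omega)]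
    have e : ((n : ℤ) + 1).toNat = n + 1 := by omega
    rw [e, add_sub_cancel_right, Int.toNat_natCast, Nat.factorial_succ]
    push_cast
    rw [mul_inv, ← mul_assoc, mul_inv_cancel₀ (by positivity), one_mul]

/-- `det [1 / (b_j - a_i)!]`. -/
noncomputable def invFactDet {n : ℕ} (a b : Fin n → ℤ) : ℝ :=
  Matrix.det (Matrix.of fun i j => invFact (b j - a i))

theorem invFactDet_apply {n : ℕ} (a b : Fin n → ℤ) :
    invFactDet a b = ∑ σ : Equiv.Perm (Fin n), ((Equiv.Perm.sign σ : ℤ) : ℝ) *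
      ∏ i, invFact (b i - a (σ i)) := by
  rw [invFactDet, Matrix.det_apply']
  rfl

theorem invFactDet_eq_zero {n : ℕ} {a : Fin n → ℤ} (b : Fin n → ℤ)
    (h : ¬ Function.Injective a) : invFactDet a b = 0 := by
  obtain ⟨i, j, hij, hne⟩ : ∃ i j, a i = a j ∧ i ≠ j := by
    simpa [Function.Injective] using h
  exact Matrix.det_zero_of_row_eq hne (by ext k; simp [hij])

/-- The discrete backward equation for `invFactDet`. -/
theorem sum_invFactDet {n : ℕ} (a b : Fin n → ℤ) :
    ∑ k, invFactDet (a + Pi.single k 1) b = ((∑ i, b i - ∑ i, a i : ℤ) : ℝ) * invFactDet a b := by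
  simp only [invFactDet_apply]
  rw [Finset.sum_comm, Finset.mul_sum]
  refine Finset.sum_congr rfl fun σ _ => ?_
  rw [← Finset.mul_sum, ← mul_assoc, mul_comm _ ((Equiv.Perm.sign σ : ℤ) : ℝ), mul_assoc]
  congr 1
  rw [← Equiv.sum_comp σ, ← Equiv.sum_comp σ a, ← Finset.sum_sub_distrib, Int.cast_sum,
    Finset.sum_mul]
  refine Finset.sum_congr rfl fun k _ => ?_
  rw [← Finset.mul_prod_erase _ _ (Finset.mem_univ k),
    ← Finset.mul_prod_erase _ (fun i => invFact (b i - a (σ i))) (Finset.mem_univ k), ← mul_assoc]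
  congr 1
  · rw [← invFact_sub_one]
    congr 1
    simp
    ring
  · refine Finset.prod_congr rfl fun i hi => ?_
    have : σ i ≠ σ k := fun h => (Finset.ne_of_mem_erase hi) (σ.injective h)
    simp [Pi.single_eq_of_ne this]

/-- A surviving Leibniz term needs a (σ i) ≤ b i for all i, and the assumption on the sums forces
equality. Then a ∘ σ = b is increasing, hence σ = 1. -/
theorem invFactDet_of_sum_le {n : ℕ} {a b : Fin n → ℤ} (ha : StrictMono a) (hb : StrictMono b)
    (h : ∑ i, b i ≤ ∑ i, a i) : invFactDet a b = if a = b then 1 else 0 := by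
  have key : ∀ σ : Equiv.Perm (Fin n), (∀ i, invFact (b i - a (σ i)) ≠ 0) → ∀ i, a (σ i) = b i := by
    intro σ hσ
    have hle : ∀ i, a (σ i) ≤ b i := by
      intro i
      by_contra hlt
      exact hσ i (invFact_of_neg (by omega))
    have hs : ∑ i, a (σ i) = ∑ i, b i :=
      le_antisymm (Finset.sum_le_sum fun i _ => hle i) (by rw [Equiv.sum_comp σ a]; exact h)
    exact fun i => (Finset.sum_eq_sum_iff_of_le fun i _ => hle i).1 hs i (Finset.mem_univ i)
  have hd : invFactDet a b = ∏ i, invFact (b i - a i) := by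
    refine det_eq_prod_diag _ fun σ hσ i j hij => ?_
    rw [← ha.lt_iff_lt, key σ hσ i, key σ hσ j]
    exact hb hij
  rw [hd]
  split_ifs with hab
  · subst hab
    simp [invFact]
  · by_contra hne
    apply hab
    funext i
    exact key 1 (fun i => fun h0 => hne (Finset.prod_eq_zero (Finset.mem_univ i) h0)) i

/-! ### Poisson weights and Poisson determinants -/

theorem poissonWeight_eq (t : ℝ≥0) (d : ℤ) :
    poissonWeight t d = Real.exp (-(t : ℝ)) * ((t : ℝ) ^ d.toNat * invFact d) := by
  unfold poissonWeight invFact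
  split_ifs
  · rw [div_eq_mul_inv, mul_assoc]
  · simp

/-- `Int.toNat` is additive on non-negative integers only, but a negative d i makes both sides
vanish through its `invFact`. -/
theorem prod_pow_toNat_mul_invFact {n : ℕ} (t : ℝ) (d : Fin n → ℤ) :
    ∏ i, (t ^ (d i).toNat * invFact (d i)) = t ^ (∑ i, d i).toNat * ∏ i, invFact (d i) := by
  by_cases h : ∀ i, 0 ≤ d i
  · have e : (∑ i, d i).toNat = ∑ i, (d i).toNat := by
      have : (∑ i, d i) = ((∑ i, (d i).toNat : ℕ) : ℤ) := by
        rw [Nat.cast_sum]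
        exact Finset.sum_congr rfl fun i _ => (Int.toNat_of_nonneg (h i)).symm
      rw [this, Int.toNat_natCast]
    rw [Finset.prod_mul_distrib, Finset.prod_pow_eq_pow_sum, e]
  · push Not at h
    obtain ⟨i, hi⟩ := h
    rw [Finset.prod_eq_zero (Finset.mem_univ i) (by rw [invFact_of_neg hi, mul_zero]),
      Finset.prod_eq_zero (Finset.mem_univ i) (invFact_of_neg hi), mul_zero]

/-- The sum of the differences b i - a (σ i) is the same for all σ, so the power of t is a common
factor of the Leibniz terms. -/
theorem poissonDet_eq {n : ℕ} (t : ℝ≥0) (a b : Fin n → ℤ) :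
    poissonDet t a b = Real.exp (-(n * t : ℝ)) *
      ((t : ℝ) ^ (∑ i, b i - ∑ i, a i).toNat * invFactDet a b) := by
  rw [poissonDet, Matrix.det_apply', invFactDet_apply, Finset.mul_sum, Finset.mul_sum]
  refine Finset.sum_congr rfl fun σ _ => ?_
  have h : ∏ i, (Matrix.of fun i j => poissonKernel t (a i) (b j)) (σ i) i =
      Real.exp (-(n * t : ℝ)) * ((t : ℝ) ^ (∑ i, b i - ∑ i, a i).toNat *
        ∏ i, invFact (b i - a (σ i))) := by
    simp only [Matrix.of_apply, poissonKernel, poissonWeight_eq]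
    rw [Finset.prod_mul_distrib, prod_pow_toNat_mul_invFact, Finset.sum_sub_distrib,
      Equiv.sum_comp σ a, Finset.prod_const, ← Real.exp_nat_mul]
    simp
  rw [h]
  ring

/-- Iterates t ω_t(y - 1) = y ω_t(y). Shifts of the weight thus become monic polynomials, ready for
a Vandermonde determinant. -/
theorem poissonWeight_sub_mul_pow (t : ℝ≥0) (y : ℤ) (i : ℕ) :
    poissonWeight t (y - i) * (t : ℝ) ^ i =
      poissonWeight t y * (descPochhammer ℝ i).eval (y : ℝ) := by
  have one : ∀ y : ℤ, poissonWeight t (y - 1) * t = poissonWeight t y * y := by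
    intro y
    rw [poissonWeight_eq, poissonWeight_eq, invFact_sub_one]
    rcases le_or_gt y 0 with h | h
    · rcases h.lt_or_eq with h | rfl
      · rw [invFact_of_neg h]; simp
      · simp
    · have : y.toNat = (y - 1).toNat + 1 := by omega
      rw [this, pow_succ]
      ring
  induction i with
  | zero => simp
  | succ i ih =>
    have e : y - ((i + 1 : ℕ) : ℤ) = (y - i) - 1 := by push_cast; ring
    rw [pow_succ', ← mul_assoc, e, one, descPochhammer_succ_eval, ← mul_assoc, ← ih]
    push_cast
    ring

/-- Started from the packed configuration, the determinant of Poisson kernels is the density of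
the Charlier ensemble. -/
theorem poissonDet_packed (n : ℕ) {t : ℝ≥0} (ht : 0 < t) :
    ∃ c : ℝ, ∀ x : Fin n → ℤ, poissonDet t (fun i => -(n : ℤ) + (i : ℕ)) x =
      c * (vandermonde x * ∏ i, poissonWeight t (x i + n)) := by
  have ht' : (t : ℝ) ≠ 0 := by exact_mod_cast ht.ne'
  -- Row i contains ω_t shifted by i; trading the shift for a falling factorial of degree i costs
  -- t^(-i).
  refine ⟨∏ i : Fin n, ((t : ℝ) ^ (i : ℕ))⁻¹, fun x => ?_⟩
  have h1 : poissonDet t (fun i => -(n : ℤ) + (i : ℕ)) x =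
      Matrix.det (Matrix.of fun i j : Fin n => ((t : ℝ) ^ (i : ℕ))⁻¹ *
        (Matrix.of fun i j : Fin n => poissonWeight t (x j + n) *
          (Matrix.of fun i j : Fin n =>
            ((descPochhammer ℝ j).eval ((x i : ℝ) + n)))ᵀ i j) i j) := by
    unfold poissonDet
    congr 1
    ext i j
    simp only [Matrix.of_apply, Matrix.transpose_apply, poissonKernel]
    rw [eq_inv_mul_iff_mul_eq₀ (pow_ne_zero _ ht'), mul_comm]
    have := poissonWeight_sub_mul_pow t (x j + n) i
    push_cast at this
    rw [← this]
    congr 2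
    ring
  rw [h1, Matrix.det_mul_column, Matrix.det_mul_row, Matrix.det_transpose,
    ← Matrix.det_eval_matrixOfPolynomials_eq_det_vandermonde (fun i => (x i : ℝ) + n)
      (fun j => descPochhammer ℝ j) (fun j => descPochhammer_natDegree ℝ j)
      (fun j => monic_descPochhammer ℝ j), Matrix.det_vandermonde]
  congr 1
  rw [mul_comm]
  congr 1
  refine Finset.prod_congr rfl fun i _ => Finset.prod_congr rfl fun j _ => ?_
  ring

/-! ### Restriction to lower levels -/

/-- The lower `n` levels of a pattern. -/
def GT.proj {N : ℕ} (x : GT N) (n : ℕ) (hn : n ≤ N) : GT n :=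
  ⟨fun j k => x.1 ⟨j, by omega⟩ k, fun j => x.2.1 ⟨j, by omega⟩,
    fun j k => x.2.2 ⟨j, by omega⟩ k⟩

/-- The top level of a pattern. -/
def GT.top {N : ℕ} (x : GT N) : Fin N → ℤ := x.1 (Fin.last N)

theorem GT.strictMono_top {N : ℕ} (x : GT N) : StrictMono x.top := x.2.1 (Fin.last N)

theorem GT.ext_apply {N : ℕ} {x y : GT N} (h : ∀ n k, x.1 n k = y.1 n k) : x = y :=
  Subtype.ext (funext fun n => funext fun k => h n k)

/-- A particle of the lower `n` levels, as a particle of the full pattern. -/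
def liftParticle {n N : ℕ} (hn : n ≤ N) (p : Particle n) : Particle N :=
  ⟨⟨p.1, by omega⟩, p.2⟩

theorem liftParticle_injective {n N : ℕ} (hn : n ≤ N) :
    Function.Injective (liftParticle hn) := by
  rintro ⟨⟨a, ha⟩, b⟩ ⟨⟨a', ha'⟩, b'⟩ h
  simp only [liftParticle, Sigma.mk.injEq, Fin.mk.injEq] at h
  obtain ⟨rfl, h⟩ := h
  rw [eq_of_heq h]

theorem blocked_liftParticle {n N : ℕ} (hn : n ≤ N) (p : Particle n) (x : GT N) :
    Blocked x.1 (liftParticle hn p) ↔ Blocked (x.proj n hn).1 p := by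
  constructor
  · rintro ⟨l, j, h1, h2, h3⟩
    exact ⟨⟨l, by have := p.1.isLt; simp only [liftParticle] at h1; omega⟩, j, h1, h2, h3⟩
  · rintro ⟨l, j, h1, h2, h3⟩
    exact ⟨⟨l, by omega⟩, j, h1, h2, h3⟩

/-- Blocking depends on the level just below and pushing acts upwards only, so the levels above n
have no influence on those up to n. -/
theorem proj_ring_liftParticle {n N : ℕ} (hn : n ≤ N) (p : Particle n) (x : GT N) :
    (ring (liftParticle hn p) x).proj n hn = ring p (x.proj n hn) := by
  refine GT.ext_apply fun j k => ?_
  classical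
  exact if_congr (and_congr (not_congr (blocked_liftParticle hn p x)) Iff.rfl) rfl rfl

theorem proj_ring_of_lt {n N : ℕ} (hn : n ≤ N) (p : Particle N) (hp : n < (p.1 : ℕ)) (x : GT N) :
    (ring p x).proj n hn = x.proj n hn := by
  refine GT.ext_apply fun j k => ?_
  simp only [GT.proj, ring, ringArr]
  refine if_neg fun h => ?_
  have h1 := h.2.1
  have := j.isLt
  simp only at h1
  omega

theorem exists_liftParticle {n N : ℕ} (hn : n ≤ N) (p : Particle N) (hp : (p.1 : ℕ) ≤ n) :
    ∃ p' : Particle n, liftParticle hn p' = p :=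
  ⟨⟨⟨p.1, by omega⟩, p.2⟩, rfl⟩

theorem sum_proj_ring {M : Type*} [AddCommMonoid M] {n N : ℕ} (hn : n ≤ N) (f : GT n → M)
    (x : GT N) :
    ∑ p : Particle N, f ((ring p x).proj n hn) =
      ∑ p : Particle n, f (ring p (x.proj n hn)) +
        (Fintype.card (Particle N) - Fintype.card (Particle n)) • f (x.proj n hn) := by
  classical
  rw [← Finset.sum_add_sum_compl (Finset.univ.map ⟨_, liftParticle_injective hn⟩), Finset.sum_map]
  congr 1
  · exact Finset.sum_congr rfl fun p _ => congrArg f (proj_ring_liftParticle hn p x)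
  · rw [Finset.sum_congr rfl (g := fun _ => f (x.proj n hn)), Finset.sum_const, Finset.card_compl,
      Finset.card_map, Finset.card_univ]
    intro p hp
    rw [proj_ring_of_lt]
    by_contra hlt
    obtain ⟨p', rfl⟩ := exists_liftParticle hn p (not_lt.1 hlt)
    simp at hp

/-! ### Adding a level -/

theorem Interlaces.strictMono_right {n : ℕ} {x : Fin n → ℤ} {y : Fin (n + 1) → ℤ}
    (h : Interlaces x y) : StrictMono y :=
  Fin.strictMono_iff_lt_succ.2 fun i => (h i).1.trans_le (h i).2

theorem Interlaces.strictMono_left {n : ℕ} {x : Fin n → ℤ} {y : Fin (n + 1) → ℤ}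
    (h : Interlaces x y) : StrictMono x := by
  rcases n with _ | n
  · exact fun i => i.elim0
  · exact Fin.strictMono_iff_lt_succ.2 fun i =>
      (h i.castSucc).2.trans_lt (by rw [Fin.succ_castSucc]; exact (h i.succ).1)

/-- The pattern with lower levels `z` and top level `y`. -/
def GT.snoc {N : ℕ} (z : GT N) (y : Fin (N + 1) → ℤ) (h : Interlaces z.top y) : GT (N + 1) :=
  ⟨fun n k => if hn : (n : ℕ) ≤ N then z.1 ⟨n, by omega⟩ k else y ⟨k, by omega⟩, by
    constructor
    · intro n
      by_cases hn : (n : ℕ) ≤ N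
      · simpa only [dif_pos hn] using z.2.1 ⟨n, by omega⟩
      · simp only [dif_neg hn]
        exact fun i j hij => h.strictMono_right hij
    · intro n k
      have h1 : (n.castSucc : ℕ) ≤ N := by simp only [Fin.val_castSucc]; omega
      simp only [dif_pos h1]
      by_cases hn : (n.succ : ℕ) ≤ N
      · simp only [dif_pos hn]
        exact z.2.2 ⟨n, hn⟩ k
      · simp only [dif_neg hn]
        obtain ⟨n, hn'⟩ := n
        simp only [Fin.succ_mk] at hn
        obtain rfl : n = N := by omega
        exact h k⟩

theorem GT.proj_snoc {N : ℕ} (z : GT N) (y : Fin (N + 1) → ℤ) (h : Interlaces z.top y) :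
    (z.snoc y h).proj N N.le_succ = z := by
  refine GT.ext_apply fun j k => ?_
  simp only [GT.proj, GT.snoc]
  rw [dif_pos (by omega)]

theorem GT.top_snoc {N : ℕ} (z : GT N) (y : Fin (N + 1) → ℤ) (h : Interlaces z.top y) :
    (z.snoc y h).top = y := by
  funext k
  simp only [GT.top, GT.snoc]
  rw [dif_neg (by simp)]

theorem GT.interlaces_top {N : ℕ} (x : GT (N + 1)) :
    Interlaces (x.proj N N.le_succ).top x.top :=
  x.2.2 (Fin.last N)

theorem GT.eq_of_proj_of_top {N : ℕ} {x x' : GT (N + 1)}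
    (h1 : x.proj N N.le_succ = x'.proj N N.le_succ) (h2 : x.top = x'.top) : x = x' := by
  refine GT.ext_apply fun n k => ?_
  by_cases hn : (n : ℕ) ≤ N
  · have := congrArg (fun w : GT N => w.1 ⟨n, by omega⟩ k) h1
    exact this
  · obtain ⟨n, hn'⟩ := n
    obtain rfl : n = N + 1 := by simp only at hn; omega
    exact congrFun h2 k

/-- Patterns are pairs of their lower levels and an interlacing top level. -/
def GT.snocEquiv (N : ℕ) :
    {zy : GT N × (Fin (N + 1) → ℤ) // Interlaces zy.1.top zy.2} ≃ GT (N + 1) where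
  toFun zy := zy.1.1.snoc zy.1.2 zy.2
  invFun x := ⟨(x.proj N N.le_succ, x.top), x.interlaces_top⟩
  left_inv zy := Subtype.ext (Prod.ext (GT.proj_snoc _ _ zy.2) (GT.top_snoc _ _ zy.2))
  right_inv _ := GT.eq_of_proj_of_top (GT.proj_snoc _ _ _) (GT.top_snoc _ _ _)

open Classical in
theorem tsum_GT_succ {N : ℕ} (H : GT N → (Fin (N + 1) → ℤ) → ENNReal) :
    ∑' x : GT (N + 1), H (x.proj N N.le_succ) x.top =
      ∑' (z : GT N) (y : Fin (N + 1) → ℤ), if Interlaces z.top y then H z y else 0 := by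
  rw [← (GT.snocEquiv N).tsum_eq, ← ENNReal.tsum_prod
    (f := fun z y => if Interlaces z.top y then H z y else 0)]
  have := tsum_subtype {zy : GT N × (Fin (N + 1) → ℤ) | Interlaces zy.1.top zy.2}
    (fun zy => H zy.1 zy.2)
  simp only [Set.indicator_apply, Set.mem_ofPred_eq] at this
  rw [← this]
  refine tsum_congr fun zy => ?_
  simp only [GT.snocEquiv, Equiv.coe_fn_mk, GT.proj_snoc, GT.top_snoc]

/-! ### The top level after a ring -/

theorem GT.le_of_diag {N : ℕ} (x : GT N) (p q : Particle N) (h : (p.1 : ℕ) ≤ q.1)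
    (hd : (q.2 : ℕ) + p.1 = p.2 + q.1) : x.1 p.1 p.2 ≤ x.1 q.1 q.2 := by
  obtain ⟨⟨a, ha⟩, ⟨b, hb⟩⟩ := p
  obtain ⟨⟨c, hc⟩, ⟨d, hd'⟩⟩ := q
  simp only at h hd hb hd' ⊢
  obtain ⟨r, rfl⟩ := Nat.exists_eq_add_of_le h
  obtain rfl : d = b + r := by omega
  clear h hd
  induction r with
  | zero => exact le_rfl
  | succ r ih =>
    exact (ih (by omega) (by omega)).trans (x.2.2 ⟨a + r, by omega⟩ ⟨b + r, by simp only; omega⟩).2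

-- Positions increase weakly along a diagonal, so a top particle at the site of the ringing particle
-- has the whole diagonal in between at that site. Hence the response of the top level depends on
-- the lower pattern only through the level just below, before and after the ring.
open Classical in
theorem top_ring_liftParticle {N : ℕ} (p : Particle N) (x : GT (N + 1)) (j : Fin (N + 1)) :
    (ring (liftParticle N.le_succ p) x).top j = x.top j +
      if ∃ i : Fin N, i.succ = j ∧ (x.proj N N.le_succ).top i = x.top j ∧
        (ring p (x.proj N N.le_succ)).top i = (x.proj N N.le_succ).top i + 1 then 1 else 0 := by
  set z := x.proj N N.le_succ with hz
  have hmove : ∀ i : Fin N, (ring p z).top i = z.top i + 1 ↔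
      ¬ Blocked z.1 p ∧ Carried z.1 p ⟨Fin.last N, i⟩ := by
    intro i
    simp only [GT.top, ring, ringArr]
    split_ifs with h
    · simp [h]
    · simp [h]
  have hL : (ring (liftParticle N.le_succ p) x).top j =
      if ¬ Blocked z.1 p ∧ Carried x.1 (liftParticle N.le_succ p) ⟨Fin.last (N + 1), j⟩ then
        x.top j + 1 else x.top j := by
    simp only [GT.top, ring, ringArr, blocked_liftParticle, hz]
  have hiff : (¬ Blocked z.1 p ∧ Carried x.1 (liftParticle N.le_succ p) ⟨Fin.last (N + 1), j⟩) ↔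
      ∃ i : Fin N, i.succ = j ∧ z.top i = x.top j ∧
        (ring p z).top i = z.top i + 1 := by
    simp only [hmove]
    constructor
    · rintro ⟨hb, -, hd, hv⟩
      simp only [Fin.val_last, liftParticle] at hd hv
      have h1 := p.1.isLt
      have h2 := p.2.isLt
      have h3 := j.isLt
      obtain ⟨i, rfl⟩ : ∃ i : Fin N, i.succ = j := by
        refine ⟨⟨(j : ℕ) - 1, by omega⟩, Fin.ext ?_⟩
        simp only [Fin.val_succ]
        omega
      simp only [Fin.val_succ] at hd
      have hle := z.le_of_diag p ⟨Fin.last N, i⟩ (by simp only [Fin.val_last]; omega)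
        (by simp only [Fin.val_last]; omega)
      have hge := (x.interlaces_top i).2
      have hv' : x.top i.succ = z.1 p.1 p.2 := hv
      have e : z.top i = z.1 (Fin.last N) i := rfl
      rw [← hz] at hge
      simp only at hle
      refine ⟨i, rfl, by omega, hb, ?_, ?_, ?_⟩
      · simp only [Fin.val_last]; omega
      · simp only [Fin.val_last]; omega
      · simp only; omega
    · rintro ⟨i, rfl, hv, hb, h1, h2, h3⟩
      refine ⟨hb, ?_, ?_, ?_⟩
      · simp only [Fin.val_last, liftParticle] at h1 ⊢; omega
      · simp only [Fin.val_last, liftParticle, Fin.val_succ] at h2 ⊢; omega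
      · have e : z.top i = z.1 (Fin.last N) i := rfl
        have e' : x.1 (Fin.last (N + 1)) i.succ = x.top i.succ := rfl
        have e'' : x.1 (liftParticle N.le_succ p).1 (liftParticle N.le_succ p).2 =
          z.1 p.1 p.2 := rfl
        simp only at h3 ⊢
        rw [e', e'', ← hv, e, h3]
  rw [hL]
  simp only [hiff]
  split_ifs <;> simp

open Classical in
theorem top_ring_last {N : ℕ} (k : Fin (N + 1)) (x : GT (N + 1)) :
    (ring ⟨Fin.last (N + 1), k⟩ x).top =
      if ∃ i : Fin N, i.castSucc = k ∧ x.top k + 1 = (x.proj N N.le_succ).top i then x.top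
      else x.top + Pi.single k 1 := by
  have hb : Blocked x.1 ⟨Fin.last (N + 1), k⟩ ↔
      ∃ i : Fin N, i.castSucc = k ∧ x.top k + 1 = (x.proj N N.le_succ).top i := by
    constructor
    · rintro ⟨⟨l, hl⟩, j, h1, h2, h3⟩
      simp only [Fin.val_last] at h1 h2
      obtain rfl : l = N := by omega
      exact ⟨j, Fin.ext h2, h3⟩
    · rintro ⟨i, rfl, h⟩
      exact ⟨⟨N, by omega⟩, i, rfl, rfl, h⟩
  funext j
  by_cases h : Blocked x.1 ⟨Fin.last (N + 1), k⟩
  · rw [if_pos (hb.1 h)]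
    simp [GT.top, ring, ringArr, h]
  · rw [if_neg (fun h' => h (hb.2 h'))]
    have hc : Carried x.1 ⟨Fin.last (N + 1), k⟩ ⟨Fin.last (N + 1), j⟩ ↔ j = k := by
      constructor
      · rintro ⟨-, h2, -⟩
        exact Fin.ext (by simp only at h2; omega)
      · rintro rfl
        exact ⟨le_rfl, rfl, rfl⟩
    simp only [GT.top, ring, ringArr, h, hc, Pi.add_apply, Pi.single_apply, not_false_eq_true,
      true_and]
    split_ifs <;> simp

/-! ### The sum over all patterns with a given top level -/

open Classical in
/-- The sum of `f` over all patterns with top level `a`. -/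
noncomputable def levelSum {N : ℕ} (f : GT N → ENNReal) (a : Fin N → ℤ) : ENNReal :=
  ∑' w : GT N, if w.top = a then f w else 0

theorem levelSum_of_not_strictMono {N : ℕ} (f : GT N → ENNReal) {a : Fin N → ℤ}
    (ha : ¬ StrictMono a) : levelSum f a = 0 := by
  refine ENNReal.tsum_eq_zero.2 fun w => if_neg ?_
  rintro rfl
  exact ha w.strictMono_top

theorem levelSum_congr {N : ℕ} {f g : GT N → ENNReal} {a : Fin N → ℤ}
    (h : ∀ w : GT N, w.top = a → f w = g w) : levelSum f a = levelSum g a :=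
  tsum_congr fun w => by
    split_ifs with hw
    · exact h w hw
    · rfl

theorem tsum_levelSum {N : ℕ} (f : GT N → ENNReal) : ∑' a, levelSum f a = ∑' w, f w := by
  unfold levelSum
  rw [ENNReal.tsum_comm]
  exact tsum_congr fun w => by rw [tsum_eq_single w.top (fun a h => if_neg h.symm), if_pos rfl]

-- The recursion in the height: above a fixed level x, what matters of the lower pattern is that its
-- top level x interlaces with y.
open Classical in
theorem levelSum_succ {N : ℕ} (H : GT N → (Fin (N + 1) → ℤ) → ENNReal) (y : Fin (N + 1) → ℤ) :
    levelSum (fun x : GT (N + 1) => H (x.proj N N.le_succ) x.top) y =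
      ∑' x, if Interlaces x y then levelSum (fun z => H z y) x else 0 := by
  have h1 := tsum_GT_succ fun z y' => if y' = y then H z y' else 0
  unfold levelSum
  rw [h1]
  have h2 : ∀ z : GT N, (∑' y', if Interlaces z.top y' then if y' = y then H z y' else 0 else 0) =
      if Interlaces z.top y then H z y else 0 := by
    intro z
    rw [tsum_eq_single y (fun y' h => by simp [h])]
    simp
  simp only [h2]
  rw [← tsum_levelSum]
  refine tsum_congr fun x => ?_
  unfold levelSum
  split_ifs with hI
  · refine tsum_congr fun z => ?_
    by_cases h3 : z.top = x
    · subst h3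
      simp [hI]
    · simp [h3]
  · refine ENNReal.tsum_eq_zero.2 fun z => ?_
    by_cases h3 : z.top = x
    · subst h3
      simp [hI]
    · simp [h3]

theorem interlaces_sub_single {N : ℕ} {x : Fin N → ℤ} {y : Fin (N + 1) → ℤ} (i : Fin N)
    (h : ∀ j, j ≠ i → y j.castSucc < x j ∧ x j ≤ y j.succ) :
    Interlaces (x - Pi.single i 1) y ↔ y i.castSucc < x i - 1 ∧ x i - 1 ≤ y i.succ := by
  constructor
  · intro h'
    simpa using h' i
  · intro h' j
    by_cases hj : j = i
    · subst hj
      simpa using h'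
    · simpa [Pi.single_eq_of_ne hj] using h j hj

theorem tsum_shift {N : ℕ} (f : (Fin N → ℤ) → ENNReal) (i : Fin N) :
    ∑' x, f x = ∑' x : Fin N → ℤ, f (x - Pi.single i 1) :=
  ((Equiv.subRight (Pi.single i 1 : Fin N → ℤ)).tsum_eq f).symm

/-! ### Two adjacent levels: blocking against pushing -/

section TwoLevels

variable {N : ℕ} (g : (Fin N → ℤ) → (Fin (N + 1) → ℤ) → ENNReal)
  (hg : ∀ x y, ¬ Interlaces x y → g x y = 0) (y : Fin (N + 1) → ℤ)

open Classical in
include hg in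
/-- Blocked jumps of a top particle make up for the configurations which a jump on the level below
cannot reach without pushing. -/
theorem tsum_jump_add_blocked (i : Fin N) :
    (∑' x, if Interlaces x y ∧ x i ≠ y i.succ then g (x + Pi.single i 1) y else 0) +
      (∑' x, if Interlaces x y ∧ y i.castSucc + 1 = x i then g x y else 0) = ∑' x, g x y := by
  rw [tsum_shift _ i, ← ENNReal.tsum_add]
  -- After the shift, the jumps reach every interlacing x except those with x i at its lowest value
  -- y i.castSucc + 1, which is exactly where the upper particle is blocked.
  refine tsum_congr fun x => ?_
  rw [sub_add_cancel]
  by_cases hI : Interlaces x y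
  · rw [interlaces_sub_single i fun j _ => hI j]
    have h1 := hI i
    simp only [Pi.sub_apply, Pi.single_eq_same, hI, true_and]
    split_ifs <;> first | omega | simp
  · simp [hg x y hI]

-- An x interlacing with y after the jump has either x i = y i.succ + 1, which a push produces, or x
-- i ≤ y i.succ, where the upper particle jumped freely. By `hy` the position x i = y i.succ before
-- the push is compatible with y i.castSucc < x i.
open Classical in
include hg in
theorem tsum_push_add_free (hy : StrictMono y) (i : Fin N) :
    (∑' x, if Interlaces x y ∧ x i = y i.succ then
        g (x + Pi.single i 1) (y + Pi.single i.succ 1) else 0) +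
      (∑' x, if Interlaces x y ∧ ¬ ∃ j : Fin N, j.castSucc = i.succ ∧ y i.succ + 1 = x j then
        g x (y + Pi.single i.succ 1) else 0) = ∑' x, g x (y + Pi.single i.succ 1) := by
  rw [tsum_shift _ i, ← ENNReal.tsum_add]
  refine tsum_congr fun x => ?_
  rw [sub_add_cancel]
  by_cases hI : Interlaces x (y + Pi.single i.succ 1)
  · have hother : ∀ j, j ≠ i → y j.castSucc < x j ∧ x j ≤ y j.succ := by
      intro j hj
      have h1 := hI j
      have hs : j.succ ≠ i.succ := fun h => hj (Fin.succ_injective _ h)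
      simp only [Pi.add_apply, Pi.single_eq_of_ne hs, Pi.single_apply] at h1
      split_ifs at h1 <;> omega
    have hi := hI i
    have hne : i.castSucc ≠ i.succ := Fin.castSucc_lt_succ.ne
    simp only [Pi.add_apply, Pi.single_eq_of_ne hne, Pi.single_eq_same] at hi
    have hII : Interlaces x y ↔ x i ≤ y i.succ := by
      refine ⟨fun h => (h i).2, fun h j => ?_⟩
      by_cases hj : j = i
      · subst hj; omega
      · exact hother j hj
    have hfree : ¬ ∃ j : Fin N, j.castSucc = i.succ ∧ y i.succ + 1 = x j := by
      rintro ⟨j, hj, h⟩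
      have := (hI j).1
      rw [hj] at this
      simp only [Pi.add_apply, Pi.single_eq_same] at this
      omega
    have hlt : y i.castSucc < y i.succ := hy Fin.castSucc_lt_succ
    rw [interlaces_sub_single i hother, hII]
    simp only [Pi.sub_apply, Pi.single_eq_same, hfree, not_false_eq_true, and_true]
    split_ifs <;> first | omega | simp
  · simp [hg x _ hI]

-- The leftmost upper particle is never pushed, so its free jumps account for everything.
open Classical in
include hg in
theorem tsum_free_zero :
    (∑' x, if Interlaces x y ∧ ¬ ∃ j : Fin N, j.castSucc = 0 ∧ y 0 + 1 = x j then
        g x (y + Pi.single 0 1) else 0) = ∑' x, g x (y + Pi.single 0 1) := by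
  refine tsum_congr fun x => ?_
  by_cases hI : Interlaces x (y + Pi.single 0 1)
  · rw [if_pos]
    constructor
    · intro j
      have h1 := hI j
      simp only [Pi.add_apply, Pi.single_eq_of_ne (Fin.succ_ne_zero j), Pi.single_apply] at h1
      split_ifs at h1 <;> omega
    · rintro ⟨j, hj, h⟩
      have := (hI j).1
      rw [hj] at this
      simp only [Pi.add_apply, Pi.single_eq_same] at this
      omega
  · simp [hg x _ hI]

open Classical in
include hg in
/-- The intertwining relation between two consecutive levels. -/
theorem two_level_intertwining (hy : StrictMono y) (c : ENNReal) :
    (∑' x, if Interlaces x y then c * g x y + ∑ i : Fin N, (if x i = y i.succ then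
        g (x + Pi.single i 1) (y + Pi.single i.succ 1) else g (x + Pi.single i 1) y) else 0) +
      (∑' x, if Interlaces x y then ∑ k : Fin (N + 1),
        (if ∃ j : Fin N, j.castSucc = k ∧ y k + 1 = x j then g x y
          else g x (y + Pi.single k 1)) else 0) =
    (c + N) * (∑' x, g x y) + ∑ k : Fin (N + 1), ∑' x, g x (y + Pi.single k 1) := by
  have e1 : (∑' x, if Interlaces x y then c * g x y + ∑ i : Fin N, (if x i = y i.succ then
        g (x + Pi.single i 1) (y + Pi.single i.succ 1) else g (x + Pi.single i 1) y) else 0) =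
      c * (∑' x, g x y) + ∑ i : Fin N, ((∑' x, if Interlaces x y ∧ x i = y i.succ then
        g (x + Pi.single i 1) (y + Pi.single i.succ 1) else 0) +
        ∑' x, if Interlaces x y ∧ x i ≠ y i.succ then g (x + Pi.single i 1) y else 0) := by
    simp only [← ENNReal.tsum_add, ← ENNReal.tsum_mul_left]
    rw [← Summable.tsum_finsetSum fun _ _ => ENNReal.summable, ← ENNReal.tsum_add]
    refine tsum_congr fun x => ?_
    by_cases hI : Interlaces x y
    · simp only [hI, true_and, if_true]
      congr 1
      refine Finset.sum_congr rfl fun i _ => ?_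
      split_ifs <;> simp_all
    · simp [hI, hg x y hI]
  set T : Fin (N + 1) → ENNReal := fun k => ∑' x, if Interlaces x y ∧
    ¬ ∃ j : Fin N, j.castSucc = k ∧ y k + 1 = x j then g x (y + Pi.single k 1) else 0 with hT
  have e2 : (∑' x, if Interlaces x y then ∑ k : Fin (N + 1),
        (if ∃ j : Fin N, j.castSucc = k ∧ y k + 1 = x j then g x y
          else g x (y + Pi.single k 1)) else 0) =
      (∑ i : Fin N, ∑' x, if Interlaces x y ∧ y i.castSucc + 1 = x i then g x y else 0) +
      ∑ k : Fin (N + 1), T k := by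
    simp only [hT]
    rw [← Summable.tsum_finsetSum fun _ _ => ENNReal.summable,
      ← Summable.tsum_finsetSum fun _ _ => ENNReal.summable, ← ENNReal.tsum_add]
    refine tsum_congr fun x => ?_
    by_cases hI : Interlaces x y
    · simp only [hI, true_and, if_true]
      have e3 : (∑ i : Fin N, if y i.castSucc + 1 = x i then g x y else 0) =
          ∑ k : Fin (N + 1), if ∃ j : Fin N, j.castSucc = k ∧ y k + 1 = x j then g x y else 0 := by
        rw [Fin.sum_univ_castSucc, if_neg, add_zero]
        · refine Finset.sum_congr rfl fun i _ => ?_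
          congr 1
          refine propext ⟨fun h => ⟨i, rfl, h⟩, ?_⟩
          rintro ⟨j, hj, h⟩
          rwa [Fin.castSucc_injective _ hj] at h
        · rintro ⟨j, hj, -⟩
          exact (Fin.castSucc_lt_last j).ne hj
      rw [e3, ← Finset.sum_add_distrib]
      refine Finset.sum_congr rfl fun k _ => ?_
      split_ifs <;> simp_all
    · simp [hI]
  -- Pushes are paired with the free jumps of the pushed particle. Lower jumps without pushing are
  -- paired with blocked upper jumps, which gives N copies of the sum of g.
  rw [e1, e2]
  have hT0 : T 0 = ∑' x, g x (y + Pi.single 0 1) := tsum_free_zero g hg y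
  rw [Fin.sum_univ_succ T, Fin.sum_univ_succ, hT0]
  simp only [← tsum_push_add_free g hg y hy]
  have e4 : (N : ENNReal) * ∑' x, g x y = ∑ i : Fin N,
      ((∑' x, if Interlaces x y ∧ x i ≠ y i.succ then g (x + Pi.single i 1) y else 0) +
      (∑' x, if Interlaces x y ∧ y i.castSucc + 1 = x i then g x y else 0)) := by
    simp only [tsum_jump_add_blocked g hg y]
    simp
  rw [add_mul, e4]
  simp only [Finset.sum_add_distrib]
  ring

end TwoLevels

/-- The intertwining of the dynamics with independent particles killed at collisions: a formula
for the average of the generator over the patterns with a given top level. -/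
theorem sum_levelSum_ring {N : ℕ} (f : GT N → ENNReal) {a : Fin N → ℤ} (ha : StrictMono a) :
    ∑ p : Particle N, levelSum (fun w => f (ring p w)) a =
      ((∑ j : Fin N, (j : ℕ) : ℕ) : ENNReal) * levelSum f a +
        ∑ i : Fin N, levelSum f (a + Pi.single i 1) := by
  classical
  induction N with
  | zero =>
    have : IsEmpty (Particle 0) := ⟨fun p => by have h1 := p.1.isLt; have h2 := p.2.isLt; omega⟩
    simp
  | succ N ih =>
    set h : GT N → (Fin (N + 1) → ℤ) → ENNReal := fun z y =>
      if hI : Interlaces z.top y then f (z.snoc y hI) else 0 with hh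
    have hf : ∀ x : GT (N + 1), f x = h (x.proj N N.le_succ) x.top := by
      intro x
      simp only [hh]
      rw [dif_pos x.interlaces_top]
      exact congrArg f ((GT.snocEquiv N).right_inv x).symm
    set g : (Fin N → ℤ) → (Fin (N + 1) → ℤ) → ENNReal := fun x y =>
      levelSum (fun z => h z y) x with hgdef
    have hg : ∀ x y, ¬ Interlaces x y → g x y = 0 := by
      intro x y hI
      refine ENNReal.tsum_eq_zero.2 fun z => ?_
      split_ifs with hz
      · subst hz
        exact dif_neg hI
      · rfl
    have hgsum : ∀ y, levelSum f y = ∑' x, g x y := by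
      intro y
      rw [levelSum_congr fun w _ => hf w, levelSum_succ]
      refine tsum_congr fun x => ?_
      split_ifs with hI
      · rfl
      · exact (hg x y hI).symm
    -- The new top level when the level below moves from x to x'.
    let push : (Fin N → ℤ) → (Fin N → ℤ) → (Fin (N + 1) → ℤ) → Fin (N + 1) → ℤ := fun x x' y j =>
      y j + if ∃ i : Fin N, i.succ = j ∧ x i = y j ∧ x' i = x i + 1 then 1 else 0
    have push_self : ∀ x y, push x x y = y := by
      intro x y
      funext j
      simp [push]
    have push_single : ∀ (x : Fin N → ℤ) y i, push x (x + Pi.single i 1) y =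
        if x i = y i.succ then y + Pi.single i.succ 1 else y := by
      intro x y i
      have hiff : ∀ j, (∃ i' : Fin N, i'.succ = j ∧ x i' = y j ∧
          (x + Pi.single i 1 : Fin N → ℤ) i' = x i' + 1) ↔ j = i.succ ∧ x i = y i.succ := by
        intro j
        constructor
        · rintro ⟨i', rfl, h1, h2⟩
          have : i' = i := by
            by_contra hne
            simp [Pi.single_eq_of_ne hne] at h2
          subst this
          exact ⟨rfl, h1⟩
        · rintro ⟨rfl, h1⟩
          exact ⟨i, rfl, h1, by simp⟩
      funext j
      simp only [push, hiff]
      by_cases hx : x i = y i.succ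
      · simp [hx, Pi.single_apply]
      · simp [hx]
    have hlow : ∑ p : Particle N, levelSum (fun w => f (ring (liftParticle N.le_succ p) w)) a =
        ∑' x, if Interlaces x a then ((∑ j : Fin N, (j : ℕ) : ℕ) : ENNReal) * g x a +
          ∑ i : Fin N, (if x i = a i.succ then
            g (x + Pi.single i 1) (a + Pi.single i.succ 1) else g (x + Pi.single i 1) a) else 0 := by
      have h1 : ∀ (p : Particle N) (w : GT (N + 1)),
          f (ring (liftParticle N.le_succ p) w) =
            h (ring p (w.proj N N.le_succ)) (push (w.proj N N.le_succ).top
              (ring p (w.proj N N.le_succ)).top w.top) := by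
        intro p w
        rw [hf, proj_ring_liftParticle]
        congr 1
        funext j
        exact top_ring_liftParticle p w j
      simp only [h1]
      have h2 : ∀ p : Particle N, _ := fun p =>
        levelSum_succ (fun z y => h (ring p z) (push z.top (ring p z).top y)) a
      simp only [h2]
      rw [← Summable.tsum_finsetSum fun _ _ => ENNReal.summable]
      refine tsum_congr fun x => ?_
      split_ifs with hI
      -- With the old level frozen at x, the summand is a function of the new lower pattern alone,
      -- so the induction hypothesis applies to it.
      · have h2 : ∀ p : Particle N,
            levelSum (fun z => h (ring p z) (push z.top (ring p z).top a)) x =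
              levelSum (fun z => (fun z' => h z' (push x z'.top a)) (ring p z)) x :=
          fun p => levelSum_congr fun w hw => by rw [hw]
        have h3 : ∀ x', levelSum (fun z => h z (push x z.top a)) x' = g x' (push x x' a) :=
          fun x' => levelSum_congr fun w hw => by rw [hw]
        rw [Finset.sum_congr rfl fun p _ => h2 p,
          ih (fun z' => h z' (push x z'.top a)) hI.strictMono_left]
        simp only [h3, push_self, push_single]
        congr 1
        refine Finset.sum_congr rfl fun i _ => ?_
        split_ifs <;> rfl
      · simp
    have htop : ∑ k : Fin (N + 1), levelSum (fun w => f (ring ⟨Fin.last (N + 1), k⟩ w)) a =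
        ∑' x, if Interlaces x a then ∑ k : Fin (N + 1),
          (if ∃ j : Fin N, j.castSucc = k ∧ a k + 1 = x j then g x a
            else g x (a + Pi.single k 1)) else 0 := by
      have h1 : ∀ (k : Fin (N + 1)) (w : GT (N + 1)),
          f (ring ⟨Fin.last (N + 1), k⟩ w) = h (w.proj N N.le_succ)
            (if ∃ i : Fin N, i.castSucc = k ∧ w.top k + 1 = (w.proj N N.le_succ).top i
              then w.top else w.top + Pi.single k 1) := by
        intro k w
        rw [hf, proj_ring_of_lt N.le_succ ⟨Fin.last (N + 1), k⟩ N.lt_succ_self, top_ring_last]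
      simp only [h1]
      have h2 : ∀ k : Fin (N + 1), _ := fun k =>
        levelSum_succ (fun z y => h z (if ∃ i : Fin N, i.castSucc = k ∧ y k + 1 = z.top i
          then y else y + Pi.single k 1)) a
      simp only [h2]
      rw [← Summable.tsum_finsetSum fun _ _ => ENNReal.summable]
      refine tsum_congr fun x => ?_
      split_ifs with hI
      · refine Finset.sum_congr rfl fun k _ => ?_
        split_ifs with hb
        · exact levelSum_congr fun w hw => by rw [hw, if_pos hb]
        · exact levelSum_congr fun w hw => by rw [hw, if_neg hb]
      · simp
    have hsplit : ∑ p : Particle (N + 1), levelSum (fun w => f (ring p w)) a =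
        ∑ p : Particle N, levelSum (fun w => f (ring (liftParticle N.le_succ p) w)) a +
          ∑ k : Fin (N + 1), levelSum (fun w => f (ring ⟨Fin.last (N + 1), k⟩ w)) a := by
      rw [Fintype.sum_sigma, Fin.sum_univ_castSucc, Fintype.sum_sigma]
      rfl
    -- The constant grows by N, which is the last term of the sum of j over j < N + 1.
    rw [hsplit, hlow, htop, two_level_intertwining g hg a ha,
      Fin.sum_univ_castSucc fun j : Fin (N + 1) => (j : ℕ)]
    simp only [hgsum]
    simp

/-! ### Exponential series -/

/-- The exponential generating series `∑ t^r / r! u_r`. -/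
noncomputable def expSum (t : ℝ≥0) (u : ℕ → ENNReal) : ENNReal :=
  ∑' r : ℕ, ENNReal.ofReal ((t : ℝ) ^ r / (r.factorial : ℝ)) * u r

theorem tsum_ofReal_pow_div_factorial {s : ℝ} (hs : 0 ≤ s) :
    ∑' r : ℕ, ENNReal.ofReal (s ^ r / (r.factorial : ℝ)) = ENNReal.ofReal (Real.exp s) := by
  rw [← ENNReal.ofReal_tsum_of_nonneg (fun r => by positivity) (Real.summable_pow_div_factorial s),
    Real.exp_eq_exp_ℝ, NormedSpace.exp_eq_tsum_div]

theorem tsum_sum_antidiagonal (F G : ℕ → ENNReal) :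
    ∑' r : ℕ, ∑ m ∈ Finset.HasAntidiagonal.antidiagonal r, F m.1 * G m.2 = (∑' i, F i) * ∑' j, G j := by
  have h : ∀ r : ℕ, ∑ m ∈ Finset.HasAntidiagonal.antidiagonal r, F m.1 * G m.2 =
      ∑' m : Finset.HasAntidiagonal.antidiagonal r, F m.1.1 * G m.1.2 := fun r =>
    (Finset.tsum_subtype (Finset.HasAntidiagonal.antidiagonal r) fun m => F m.1 * G m.2).symm
  simp only [h]
  rw [← ENNReal.tsum_sigma' fun p : (r : ℕ) × Finset.HasAntidiagonal.antidiagonal r => F p.2.1.1 * G p.2.1.2]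
  have h2 := (Finset.HasAntidiagonal.sigmaAntidiagonalEquivProd (A := ℕ)).tsum_eq fun q => F q.1 * G q.2
  simp only [Finset.HasAntidiagonal.sigmaAntidiagonalEquivProd, Equiv.coe_fn_mk] at h2
  rw [h2, ENNReal.tsum_prod (f := fun a b => F a * G b)]
  simp only [ENNReal.tsum_mul_left, ENNReal.tsum_mul_right]

/-- This is exp(t(B + c)) = exp(ct) exp(tB), from the binomial theorem and the Cauchy product. In
[0, ∞] no convergence has to be checked. -/
theorem expSum_add_natCast_pow {α : Type*} (B : Module.End ENNReal (α → ENNReal)) (c : ℕ)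
    (t : ℝ≥0) (f : α → ENNReal) (a : α) :
    expSum t (fun r => ((B + (c : Module.End ENNReal (α → ENNReal))) ^ r) f a) =
      ENNReal.ofReal (Real.exp (c * t)) * expSum t (fun j => (B ^ j) f a) := by
  rw [mul_comm, ← tsum_ofReal_pow_div_factorial (by positivity), expSum, expSum,
    ← tsum_sum_antidiagonal]
  refine tsum_congr fun r => ?_
  rw [(Nat.cast_commute c B).symm.add_pow', LinearMap.sum_apply, Finset.sum_apply, Finset.mul_sum]
  refine Finset.sum_congr rfl fun m hm => ?_
  have hr : m.1 + m.2 = r := Finset.HasAntidiagonal.mem_antidiagonal.1 hm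
  have hc : ((r.choose m.1 • (B ^ m.1 * (c : Module.End ENNReal (α → ENNReal)) ^ m.2)) f) a =
      ENNReal.ofReal (r.choose m.1 * c ^ m.2 : ℝ) * (B ^ m.1) f a := by
    rw [← Nat.cast_pow, (Nat.cast_commute _ _).symm.eq]
    simp only [Module.End.mul_apply, Module.End.natCast_apply, Pi.smul_apply, nsmul_eq_mul,
      Pi.mul_apply, Pi.natCast_apply]
    rw [ENNReal.ofReal_mul (by positivity), ENNReal.ofReal_natCast,
      show ((c : ℝ) ^ m.2) = ((c ^ m.2 : ℕ) : ℝ) by push_cast; rfl, ENNReal.ofReal_natCast]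
    ring
  rw [hc, ← mul_assoc, ← ENNReal.ofReal_mul (by positivity), mul_right_comm,
    ← ENNReal.ofReal_mul (by positivity)]
  congr 2
  rw [Nat.choose_eq_factorial_div_factorial (by omega), Nat.cast_div
    (Nat.factorial_mul_factorial_dvd_factorial (by omega)) (by positivity), ← hr,
    Nat.add_sub_cancel_left, mul_pow, pow_add]
  push_cast
  have h1 : ((m.1 + m.2).factorial : ℝ) ≠ 0 := by positivity
  have h2 : (m.1.factorial : ℝ) ≠ 0 := by positivity
  have h3 : (m.2.factorial : ℝ) ≠ 0 := by positivity
  field_simp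

/-! ### The transition probabilities as exponential series -/

/-- The operator `f ↦ ∑ p, f (ring p ·)`. -/
noncomputable def ringOp (N : ℕ) : Module.End ENNReal (GT N → ENNReal) where
  toFun f x := ∑ p : Particle N, f (ring p x)
  map_add' f g := by
    funext x
    simp [Finset.sum_add_distrib]
  map_smul' c f := by
    funext x
    simp [Finset.mul_sum]

theorem ringOp_pow_succ_apply {N : ℕ} (r : ℕ) (f : GT N → ENNReal) (x : GT N) :
    (ringOp N ^ (r + 1)) f x = ∑ p : Particle N, (ringOp N ^ r) f (ring p x) := by
  rw [pow_succ', Module.End.mul_apply]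
  rfl

open Classical in
theorem ringOp_pow_single {N : ℕ} (r : ℕ) (x y : GT N) :
    (ringOp N ^ r) (Pi.single y 1) x = ringCount r x y := by
  induction r generalizing x with
  | zero => simp [ringCount, Pi.single_apply]
  | succ r ih => simp [ringOp_pow_succ_apply, ringCount, ih]

open Classical in
theorem tsum_mul_ringCount {N : ℕ} (r : ℕ) (f : GT N → ENNReal) (x : GT N) :
    ∑' y, f y * ringCount r x y = (ringOp N ^ r) f x := by
  induction r generalizing x with
  | zero =>
    rw [tsum_eq_single x (fun y hy => by simp [ringCount, hy.symm])]
    simp [ringCount]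
  | succ r ih =>
    simp only [ringOp_pow_succ_apply, ringCount, Nat.cast_sum, Finset.mul_sum, ← ih]
    rw [Summable.tsum_finsetSum fun _ _ => ENNReal.summable]

theorem ringCount_le {N : ℕ} (r : ℕ) (x y : GT N) :
    ringCount r x y ≤ Fintype.card (Particle N) ^ r := by
  induction r generalizing x with
  | zero =>
    unfold ringCount
    split_ifs <;> simp
  | succ r ih =>
    unfold ringCount
    rw [pow_succ']
    simpa using Finset.sum_le_sum fun p (_ : p ∈ Finset.univ) => ih (ring p x)

theorem ofReal_transProb {N : ℕ} (t : ℝ≥0) (x y : GT N) :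
    ENNReal.ofReal (transProb t x y) =
      ENNReal.ofReal (Real.exp (-((Fintype.card (Particle N) : ℝ) * t))) *
        expSum t (fun r => ringCount r x y) := by
  have hs : Summable fun r : ℕ => (t : ℝ) ^ r / (r.factorial : ℝ) * (ringCount r x y : ℝ) := by
    refine Summable.of_nonneg_of_le (fun r => by positivity) (fun r => ?_)
      (Real.summable_pow_div_factorial ((t : ℝ) * (Fintype.card (Particle N) : ℝ)))
    rw [mul_pow, mul_div_right_comm]
    gcongr
    exact_mod_cast ringCount_le r x y
  rw [transProb, ENNReal.ofReal_mul (by positivity),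
    ENNReal.ofReal_tsum_of_nonneg (fun r => by positivity) hs, expSum]
  congr 1
  refine tsum_congr fun r => ?_
  rw [ENNReal.ofReal_mul (by positivity), ENNReal.ofReal_natCast]

theorem tsum_mul_transProb {N : ℕ} (t : ℝ≥0) (f : GT N → ENNReal) (x : GT N) :
    ∑' y, f y * ENNReal.ofReal (transProb t x y) =
      ENNReal.ofReal (Real.exp (-((Fintype.card (Particle N) : ℝ) * t))) *
        expSum t (fun r => (ringOp N ^ r) f x) := by
  simp only [ofReal_transProb, expSum, ← tsum_mul_ringCount, ← ENNReal.tsum_mul_left]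
  rw [ENNReal.tsum_comm]
  refine tsum_congr fun r => tsum_congr fun y => ?_
  ring

theorem card_particle_le {n N : ℕ} (hn : n ≤ N) :
    Fintype.card (Particle n) ≤ Fintype.card (Particle N) :=
  Fintype.card_le_of_injective _ (liftParticle_injective hn)

theorem card_particle (N : ℕ) :
    Fintype.card (Particle N) = (∑ j : Fin N, (j : ℕ)) + N := by
  rw [Fintype.card_sigma, Fin.sum_univ_castSucc]
  simp

theorem ringOp_pow_comp_proj {n N : ℕ} (hn : n ≤ N) (r : ℕ) (f : GT n → ENNReal) (x : GT N) :
    (ringOp N ^ r) (fun z => f (z.proj n hn)) x =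
      ((ringOp n + ((Fintype.card (Particle N) - Fintype.card (Particle n) : ℕ) :
        Module.End ENNReal (GT n → ENNReal))) ^ r) f (x.proj n hn) := by
  induction r generalizing x with
  | zero => rfl
  | succ r ih =>
    simp only [ringOp_pow_succ_apply, ih]
    rw [pow_succ', Module.End.mul_apply, sum_proj_ring hn, LinearMap.add_apply,
      Module.End.natCast_apply]
    rfl

open Classical in
/-- The lower levels of the dynamics evolve autonomously. -/
theorem tsum_transProb_proj {n N : ℕ} (hn : n ≤ N) (t : ℝ≥0) (x : GT N) (z' : GT n) :
    ∑' z : GT N, (if z.proj n hn = z' then ENNReal.ofReal (transProb t x z) else 0) =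
      ENNReal.ofReal (transProb t (x.proj n hn) z') := by
  have h := tsum_mul_transProb t (fun z : GT N => (Pi.single z' 1 : GT n → ENNReal) (z.proj n hn)) x
  simp only [ringOp_pow_comp_proj, expSum_add_natCast_pow, ringOp_pow_single] at h
  simp only [Pi.single_apply, ite_mul, one_mul, zero_mul] at h
  -- Clocks above level n act as the identity on the lower levels; the resulting factor exp(ct)
  -- compensates the difference of the two total rates.
  rw [h, ofReal_transProb, ← mul_assoc, ← ENNReal.ofReal_mul (by positivity), ← Real.exp_add,
    Nat.cast_sub (card_particle_le hn)]
  congr 3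
  ring

/-! ### The transition probabilities summed over a level -/

open Classical in
/-- The generator (up to a constant) of independent particles that are killed when they collide. -/
noncomputable def killedOp (N : ℕ) : Module.End ENNReal ((Fin N → ℤ) → ENNReal) where
  toFun g a := if StrictMono a then ∑ i : Fin N, g (a + Pi.single i 1) else 0
  map_add' f g := by
    funext a
    simp only [Pi.add_apply]
    split_ifs <;> simp [Finset.sum_add_distrib]
  map_smul' c f := by
    funext a
    simp only [Pi.smul_apply, RingHom.id_apply, smul_eq_mul]
    split_ifs <;> simp [Finset.mul_sum]

/-- Outside the chamber both sides vanish, since no pattern has such a top level. For the same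
reason a jump into a collision contributes nothing, which is the killing. -/
theorem levelSum_ringOp {N : ℕ} (f : GT N → ENNReal) :
    levelSum (ringOp N f) = (killedOp N + ((∑ j : Fin N, (j : ℕ) : ℕ) :
      Module.End ENNReal ((Fin N → ℤ) → ENNReal))) (levelSum f) := by
  classical
  funext a
  rw [LinearMap.add_apply, Module.End.natCast_apply, Pi.add_apply, Pi.smul_apply, nsmul_eq_mul]
  by_cases ha : StrictMono a
  · have h1 : killedOp N (levelSum f) a = ∑ i : Fin N, levelSum f (a + Pi.single i 1) := if_pos ha
    rw [h1, add_comm, ← sum_levelSum_ring f ha]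
    unfold levelSum
    rw [← Summable.tsum_finsetSum fun _ _ => ENNReal.summable]
    refine tsum_congr fun w => ?_
    split_ifs
    · rfl
    · simp
  · have h1 : killedOp N (levelSum f) a = 0 := if_neg ha
    rw [h1, levelSum_of_not_strictMono _ ha, levelSum_of_not_strictMono _ ha]
    simp

theorem levelSum_ringOp_pow {N : ℕ} (r : ℕ) (f : GT N → ENNReal) :
    levelSum ((ringOp N ^ r) f) = ((killedOp N + ((∑ j : Fin N, (j : ℕ) : ℕ) :
      Module.End ENNReal ((Fin N → ℤ) → ENNReal))) ^ r) (levelSum f) := by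
  induction r with
  | zero => rfl
  | succ r ih => rw [pow_succ', pow_succ', Module.End.mul_apply, Module.End.mul_apply,
      levelSum_ringOp, ih]

/-- A unit jump leaves the chamber only through a collision, where the determinant vanishes because
of two equal rows. -/
theorem strictMono_or_not_injective_add_single {N : ℕ} {a : Fin N → ℤ} (ha : StrictMono a)
    (i : Fin N) : StrictMono (a + Pi.single i 1) ∨ ¬ Function.Injective (a + Pi.single i 1) := by
  by_contra! h
  refine h.1 (Monotone.strictMono_of_injective (fun j k hjk => ?_) h.2)
  rcases hjk.lt_or_eq with hlt | rfl
  · have := ha hlt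
    simp only [Pi.add_apply, Pi.single_apply]
    split_ifs <;> omega
  · exact le_rfl

-- The determinant satisfies the backward equation `sum_invFactDet` and vanishes at collisions, so
-- induction on j identifies it with the path count. Non-injective a are admitted because a jump may
-- lead there. Non-negativity is carried along since `ENNReal.ofReal` is additive only on
-- non-negative reals.
open Classical in
theorem killedOp_pow_single {N : ℕ} {b : Fin N → ℤ} (hb : StrictMono b) (j : ℕ) (a : Fin N → ℤ)
    (ha : StrictMono a ∨ ¬ Function.Injective a) :
    0 ≤ (if ∑ i, b i - ∑ i, a i = (j : ℤ) then (j.factorial : ℝ) * invFactDet a b else 0) ∧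
    (killedOp N ^ j) (Pi.single b 1) a = ENNReal.ofReal
      (if ∑ i, b i - ∑ i, a i = (j : ℤ) then (j.factorial : ℝ) * invFactDet a b else 0) := by
  rcases ha with ha | ha
  swap
  · rw [invFactDet_eq_zero b ha]
    have ha' : ¬ StrictMono a := fun h => ha h.injective
    simp only [mul_zero, ite_self, le_refl, ENNReal.ofReal_zero, true_and]
    rcases j with _ | j
    · have : a ≠ b := by rintro rfl; exact ha' hb
      simp [this]
    · rw [pow_succ', Module.End.mul_apply]
      exact if_neg ha'
  induction j generalizing a with
  | zero =>
    have h1 : (if ∑ i, b i - ∑ i, a i = ((0 : ℕ) : ℤ) then ((0 : ℕ).factorial : ℝ) * invFactDet a b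
        else 0) = if a = b then 1 else 0 := by
      split_ifs with h2 h3 h3
      · rw [invFactDet_of_sum_le ha hb (by simp only [Nat.cast_zero] at h2; omega)]
        simp [h3]
      · rw [invFactDet_of_sum_le ha hb (by simp only [Nat.cast_zero] at h2; omega)]
        simp [h3]
      · subst h3
        simp at h2
      · rfl
    rw [h1]
    constructor
    · split_ifs <;> simp
    · rw [pow_zero, Module.End.one_apply, Pi.single_apply]
      split_ifs <;> simp
  | succ j ih =>
    have key : ∀ i : Fin N,
        0 ≤ (if ∑ k, b k - ∑ k, (a + Pi.single i 1 : Fin N → ℤ) k = (j : ℤ) then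
          (j.factorial : ℝ) * invFactDet (a + Pi.single i 1) b else 0) ∧
        (killedOp N ^ j) (Pi.single b 1) (a + Pi.single i 1) = ENNReal.ofReal
          (if ∑ k, b k - ∑ k, (a + Pi.single i 1 : Fin N → ℤ) k = (j : ℤ) then
            (j.factorial : ℝ) * invFactDet (a + Pi.single i 1) b else 0) := by
      intro i
      rcases strictMono_or_not_injective_add_single ha i with h | h
      · exact ih _ h
      · rw [invFactDet_eq_zero b h]
        have h' : ¬ StrictMono (a + Pi.single i 1) := fun h2 => h h2.injective
        simp only [mul_zero, ite_self, le_refl, ENNReal.ofReal_zero, true_and]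
        rcases j with _ | j
        · have : a + Pi.single i 1 ≠ b := fun h2 => h' (h2 ▸ hb)
          simp [this]
        · rw [pow_succ', Module.End.mul_apply]
          exact if_neg h'
    have hsum : ∑ i : Fin N, (if ∑ k, b k - ∑ k, (a + Pi.single i 1 : Fin N → ℤ) k = (j : ℤ) then
          (j.factorial : ℝ) * invFactDet (a + Pi.single i 1) b else 0) =
        if ∑ i, b i - ∑ i, a i = ((j + 1 : ℕ) : ℤ) then
          ((j + 1).factorial : ℝ) * invFactDet a b else 0 := by
      have hs : ∀ i : Fin N, ∑ k, (a + Pi.single i 1 : Fin N → ℤ) k = ∑ k, a k + 1 := by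
        intro i
        simp [Finset.sum_add_distrib]
      simp only [hs]
      by_cases h : ∑ i, b i - ∑ i, a i = ((j + 1 : ℕ) : ℤ)
      · have h' : ∑ i, b i - (∑ i, a i + 1) = (j : ℤ) := by push_cast at h; omega
        simp only [h, h', if_true]
        -- The factor ∑ b - ∑ a = j + 1 of the backward equation completes the factorial.
        rw [← Finset.mul_sum, sum_invFactDet, h, Nat.factorial_succ]
        push_cast
        ring
      · have h' : ¬ ∑ i, b i - (∑ i, a i + 1) = (j : ℤ) := by push_cast at h; omega
        simp only [h, h', if_false, Finset.sum_const_zero]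
    rw [← hsum]
    refine ⟨Finset.sum_nonneg fun i _ => (key i).1, ?_⟩
    rw [ENNReal.ofReal_sum_of_nonneg fun i _ => (key i).1, pow_succ', Module.End.mul_apply]
    refine (if_pos ha).trans (Finset.sum_congr rfl fun i _ => (key i).2)

theorem invFactDet_eq_zero_of_sum_lt {N : ℕ} {a b : Fin N → ℤ} (ha : StrictMono a)
    (hb : StrictMono b) (h : ∑ i, b i < ∑ i, a i) : invFactDet a b = 0 := by
  rw [invFactDet_of_sum_le ha hb h.le, if_neg]
  rintro rfl
  exact lt_irrefl _ h

/-- Up to a factorial the determinant is a number of killed paths. -/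
theorem invFactDet_nonneg {N : ℕ} {a b : Fin N → ℤ} (ha : StrictMono a) (hb : StrictMono b) :
    0 ≤ invFactDet a b := by
  rcases lt_or_ge (∑ i, b i) (∑ i, a i) with h | h
  · rw [invFactDet_eq_zero_of_sum_lt ha hb h]
  · have h1 := (killedOp_pow_single hb (∑ i, b i - ∑ i, a i).toNat a (Or.inl ha)).1
    rw [if_pos (by omega)] at h1
    exact (mul_nonneg_iff_of_pos_left (by positivity)).1 h1

/-- The determinant of Karlin and McGregor is non-negative. -/
theorem poissonDet_nonneg {N : ℕ} (t : ℝ≥0) {a b : Fin N → ℤ} (ha : StrictMono a)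
    (hb : StrictMono b) : 0 ≤ poissonDet t a b := by
  rw [poissonDet_eq]
  have := invFactDet_nonneg ha hb
  positivity

-- Every jump raises the sum of the coordinates by one, so all paths from a to b have the same
-- length and at most one term of the series survives.
open Classical in
theorem expSum_killedOp {N : ℕ} (t : ℝ≥0) {a b : Fin N → ℤ} (ha : StrictMono a)
    (hb : StrictMono b) :
    expSum t (fun j => (killedOp N ^ j) (Pi.single b 1) a) =
      ENNReal.ofReal ((t : ℝ) ^ (∑ i, b i - ∑ i, a i).toNat * invFactDet a b) := by
  unfold expSum
  simp only [(killedOp_pow_single hb _ a (Or.inl ha)).2]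
  rcases lt_or_ge (∑ i, b i) (∑ i, a i) with h | h
  · rw [invFactDet_eq_zero_of_sum_lt ha hb h]
    simp
  · rw [tsum_eq_single (∑ i, b i - ∑ i, a i).toNat, if_pos (by omega),
      ← ENNReal.ofReal_mul (by positivity)]
    · congr 1
      field_simp
    · intro j hj
      rw [if_neg (by omega)]
      simp

/-- Summed over all initial patterns with a given top level, the transition probabilities of the
dynamics are the Karlin-McGregor determinants, whatever the lower levels of the final pattern. -/
theorem levelSum_transProb {N : ℕ} (t : ℝ≥0) {a : Fin N → ℤ} (ha : StrictMono a) (z : GT N) :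
    levelSum (fun w => ENNReal.ofReal (transProb t w z)) a =
      ENNReal.ofReal (poissonDet t a z.top) := by
  classical
  have h1 : levelSum (fun w => ENNReal.ofReal (transProb t w z)) a =
      ENNReal.ofReal (Real.exp (-((Fintype.card (Particle N) : ℝ) * t))) *
        expSum t (fun r => levelSum ((ringOp N ^ r) (Pi.single z 1)) a) := by
    simp only [ofReal_transProb, expSum, levelSum, ← ENNReal.tsum_mul_left, ringOp_pow_single]
    rw [ENNReal.tsum_comm]
    refine tsum_congr fun w => ?_
    split_ifs <;> simp [ENNReal.tsum_mul_left]
  -- Here the lower levels of z drop out: the unit mass at z becomes the unit mass at its top level.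
  have h2 : levelSum (Pi.single z 1 : GT N → ENNReal) = Pi.single z.top 1 := by
    funext x
    unfold levelSum
    rw [tsum_eq_single z (fun w hw => by simp [hw])]
    simp [Pi.single_apply, eq_comm]
  rw [h1]
  simp only [levelSum_ringOp_pow, expSum_add_natCast_pow, h2]
  -- The total rate is N(N - 1)/2 + N; the first part cancels against the constant of the
  -- intertwining, leaving exp(-Nt).
  rw [expSum_killedOp t ha z.strictMono_top, poissonDet_eq,
    ENNReal.ofReal_mul (p := Real.exp _) (by positivity), ← mul_assoc, ← ENNReal.ofReal_mul (by positivity), ← Real.exp_add, card_particle]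
  congr 3
  push_cast
  ring

/-! ### Countable state spaces and the Markov property -/

instance (n : ℕ) : Countable (Weyl n) := inferInstanceAs (Countable {x : Fin n → ℤ // StrictMono x})

instance (N : ℕ) : Countable (GT N) := inferInstanceAs (Countable {x : Arr N // IsGT x})

theorem measure_eq_tsum_fiber {Ω β : Type*} [MeasurableSpace Ω] [Countable β] (μ : Measure Ω)
    (Y : Ω → β) (hY : ∀ b, MeasurableSet {ω | Y ω = b}) (E : Set Ω) :
    μ E = ∑' b, μ (E ∩ {ω | Y ω = b}) := by
  have h1 : (⋃ b, {ω | Y ω = b}) = Set.univ := by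
    ext ω
    simp
  have h2 : Pairwise (Function.onFun Disjoint fun b => {ω | Y ω = b}) := by
    intro b c hbc
    rw [Function.onFun, Set.disjoint_left]
    rintro ω rfl h
    exact hbc h
  have h3 := measure_iUnion (μ := μ.restrict E) h2 hY
  rw [h1, Measure.restrict_apply_univ] at h3
  rw [h3]
  exact tsum_congr fun b => by rw [Measure.restrict_apply (hY b), Set.inter_comm]

section Dynamics

variable {Ω : Type*} [MeasurableSpace Ω] {μ : Measure Ω} {N : ℕ} {X : ℝ≥0 → Ω → GT N}

theorem transProb_nonneg {N : ℕ} (t : ℝ≥0) (x y : GT N) : 0 ≤ transProb t x y :=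
  mul_nonneg (Real.exp_pos _).le (tsum_nonneg fun r => by positivity)

theorem IsPackedDynamics.measure_path [IsProbabilityMeasure μ] (hX : IsPackedDynamics μ X) {r : ℕ}
    {s : Fin (r + 1) → ℝ≥0} (hs : Monotone s) (x : Fin (r + 1) → GT N) :
    μ {ω | ∀ i, X (s i) ω = x i} = μ {ω | X (s 0) ω = x 0} *
      ∏ i : Fin r, ENNReal.ofReal (transProb (s i.succ - s i.castSucc) (x i.castSucc) (x i.succ)) := by
  rw [← ENNReal.ofReal_prod_of_nonneg fun i _ => transProb_nonneg _ _ _,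
    ← ENNReal.ofReal_toReal (measure_ne_top μ {ω | X (s 0) ω = x 0}),
    ← ENNReal.ofReal_mul ENNReal.toReal_nonneg,
    ← ENNReal.ofReal_toReal (measure_ne_top μ {ω | ∀ i, X (s i) ω = x i})]
  exact congrArg ENNReal.ofReal (hX.markov r s hs x)

theorem monotone_snoc {r : ℕ} {s : Fin (r + 1) → ℝ≥0} (hs : Monotone s) {t : ℝ≥0}
    (ht : s (Fin.last r) ≤ t) : Monotone (Fin.snoc s t : Fin (r + 2) → ℝ≥0) := by
  refine Fin.monotone_iff_le_succ.2 fun i => ?_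
  induction i using Fin.lastCases with
  | last => simpa using ht
  | cast i =>
    rw [Fin.succ_castSucc, Fin.snoc_castSucc (α := fun _ => ℝ≥0),
      Fin.snoc_castSucc (α := fun _ => ℝ≥0)]
    exact hs Fin.castSucc_lt_succ.le

theorem IsPackedDynamics.measure_path_inter [IsProbabilityMeasure μ] (hX : IsPackedDynamics μ X)
    {r : ℕ} {s : Fin (r + 1) → ℝ≥0} (hs : Monotone s) {t : ℝ≥0} (ht : s (Fin.last r) ≤ t)
    (x : Fin (r + 1) → GT N) (z : GT N) :
    μ ({ω | ∀ i, X (s i) ω = x i} ∩ {ω | X t ω = z}) = μ {ω | ∀ i, X (s i) ω = x i} *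
      ENNReal.ofReal (transProb (t - s (Fin.last r)) (x (Fin.last r)) z) := by
  have h := hX.measure_path (monotone_snoc hs ht) (Fin.snoc x z : Fin (r + 2) → GT N)
  have h1 : {ω | ∀ i, X ((Fin.snoc s t : Fin (r + 2) → ℝ≥0) i) ω =
      (Fin.snoc x z : Fin (r + 2) → GT N) i} =
      {ω | ∀ i, X (s i) ω = x i} ∩ {ω | X t ω = z} := by
    ext ω
    simp only [Set.mem_ofPred_eq, Set.mem_inter_iff, Fin.forall_fin_succ', Fin.snoc_castSucc,
      Fin.snoc_last]
  have h0 : (0 : Fin (r + 2)) = (0 : Fin (r + 1)).castSucc := rfl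
  rw [h1, Fin.prod_univ_castSucc] at h
  simp only [Fin.succ_castSucc, Fin.succ_last, h0, Fin.snoc_castSucc, Fin.snoc_last] at h
  rw [h, ← mul_assoc, hX.measure_path hs x]

/-- The event `E` depends on the values of `X` at finitely many times up to `t`. -/
def PastEvent (X : ℝ≥0 → Ω → GT N) (E : Set Ω) (t : ℝ≥0) : Prop :=
  ∃ (r : ℕ) (s : Fin (r + 1) → ℝ≥0) (A : Set (Fin (r + 1) → GT N)),
    Monotone s ∧ s (Fin.last r) = t ∧ E = {ω | (fun i => X (s i) ω) ∈ A}

omit [MeasurableSpace Ω] in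
theorem pastEvent_univ (X : ℝ≥0 → Ω → GT N) (t : ℝ≥0) : PastEvent X Set.univ t :=
  ⟨0, fun _ => t, Set.univ, monotone_const, rfl, by simp⟩

omit [MeasurableSpace Ω] in
theorem PastEvent.inter {E : Set Ω} {t t' : ℝ≥0} (hE : PastEvent X E t) (h : t ≤ t')
    (B : Set (GT N)) : PastEvent X (E ∩ {ω | X t' ω ∈ B}) t' := by
  obtain ⟨r, s, A, hs, rfl, rfl⟩ := hE
  refine ⟨r + 1, Fin.snoc s t', {u | (fun i : Fin (r + 1) => u i.castSucc) ∈ A ∧ u (Fin.last _) ∈ B},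
    monotone_snoc hs h, Fin.snoc_last (α := fun _ => ℝ≥0) _ _, ?_⟩
  ext ω
  simp only [Set.mem_ofPred_eq, Set.mem_inter_iff, Fin.snoc_castSucc, Fin.snoc_last]

/-- Splitting along the whole observed path, which takes countably many values, reduces the claim to
the finite-dimensional distributions. -/
theorem PastEvent.measure_inter [IsProbabilityMeasure μ] (hX : IsPackedDynamics μ X) {E : Set Ω}
    {t t' : ℝ≥0} (hE : PastEvent X E t) (h : t ≤ t') (w z : GT N) :
    μ (E ∩ {ω | X t' ω = z} ∩ {ω | X t ω = w}) = μ (E ∩ {ω | X t ω = w}) *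
      ENNReal.ofReal (transProb (t' - t) w z) := by
  obtain ⟨r, s, A, hs, rfl, rfl⟩ := hE
  have hY : ∀ x : Fin (r + 1) → GT N, MeasurableSet {ω | (fun i => X (s i) ω) = x} := by
    intro x
    have : {ω | (fun i => X (s i) ω) = x} = ⋂ i, {ω | X (s i) ω = x i} := by
      ext ω
      simp [funext_iff]
    rw [this]
    exact MeasurableSet.iInter fun i => hX.measurable _ _
  rw [measure_eq_tsum_fiber μ _ hY, measure_eq_tsum_fiber μ _ hY ({ω | _ ∈ A} ∩ _),
    ← ENNReal.tsum_mul_right]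
  refine tsum_congr fun x => ?_
  by_cases hx : x ∈ A ∧ x (Fin.last r) = w
  · obtain ⟨hx, rfl⟩ := hx
    have h1 : {ω | (fun i => X (s i) ω) ∈ A} ∩ {ω | X t' ω = z} ∩
        {ω | X (s (Fin.last r)) ω = x (Fin.last r)} ∩ {ω | (fun i => X (s i) ω) = x} =
        {ω | ∀ i, X (s i) ω = x i} ∩ {ω | X t' ω = z} := by
      ext ω
      simp only [Set.mem_ofPred_eq, Set.mem_inter_iff]
      constructor
      · rintro ⟨⟨⟨-, h1⟩, -⟩, h2⟩
        exact ⟨congrFun h2, h1⟩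
      · rintro ⟨h1, h2⟩
        have h3 : (fun i => X (s i) ω) = x := funext h1
        exact ⟨⟨⟨h3 ▸ hx, h2⟩, h1 _⟩, h3⟩
    have h2 : {ω | (fun i => X (s i) ω) ∈ A} ∩
        {ω | X (s (Fin.last r)) ω = x (Fin.last r)} ∩ {ω | (fun i => X (s i) ω) = x} =
        {ω | ∀ i, X (s i) ω = x i} := by
      ext ω
      simp only [Set.mem_ofPred_eq, Set.mem_inter_iff]
      constructor
      · rintro ⟨-, h2⟩
        exact congrFun h2
      · intro h1
        have h3 : (fun i => X (s i) ω) = x := funext h1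
        exact ⟨⟨h3 ▸ hx, h1 _⟩, h3⟩
    rw [h1, h2, hX.measure_path_inter hs h]
  · have h1 : ∀ E : Set Ω, E ⊆ {ω | (fun i => X (s i) ω) ∈ A} → E ⊆ {ω | X (s (Fin.last r)) ω = w} →
        E ∩ {ω | (fun i => X (s i) ω) = x} = ∅ := by
      intro E hE1 hE2
      refine Set.eq_empty_of_forall_notMem fun ω hω => ?_
      have h2 : (fun i => X (s i) ω) = x := hω.2
      exact hx ⟨h2 ▸ hE1 hω.1, (congrFun h2 _).symm.trans (hE2 hω.1)⟩
    rw [h1 _ (fun ω hω => hω.1.1) (fun ω hω => hω.2), h1 _ (fun ω hω => hω.1) (fun ω hω => hω.2)]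
    simp

open Classical in
theorem IsPackedDynamics.measure_proj (hX : IsPackedDynamics μ X) {n : ℕ} (hn : n ≤ N) (t : ℝ≥0)
    (E : Set Ω) (z : GT n) :
    μ (E ∩ {ω | (X t ω).proj n hn = z}) =
      ∑' w : GT N, if w.proj n hn = z then μ (E ∩ {ω | X t ω = w}) else 0 := by
  rw [measure_eq_tsum_fiber μ _ (hX.measurable t)]
  refine tsum_congr fun w => ?_
  split_ifs with hw
  · congr 1
    ext ω
    simp only [Set.mem_ofPred_eq, Set.mem_inter_iff]
    constructor
    · rintro ⟨⟨h1, -⟩, h2⟩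
      exact ⟨h1, h2⟩
    · rintro ⟨h1, h2⟩
      exact ⟨⟨h1, h2 ▸ hw⟩, h2⟩
  · convert measure_empty (μ := μ)
    refine Set.eq_empty_of_forall_notMem ?_
    rintro ω ⟨⟨-, h1⟩, h2⟩
    exact hw (by rw [← h1, ← (h2 : X t ω = w)])

theorem IsPackedDynamics.measurableSet_proj (hX : IsPackedDynamics μ X) {n : ℕ} (hn : n ≤ N)
    (t : ℝ≥0) (z : GT n) : MeasurableSet {ω | (X t ω).proj n hn = z} := by
  have : {ω | (X t ω).proj n hn = z} =
      ⋃ w ∈ {w : GT N | w.proj n hn = z}, {ω | X t ω = w} := by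
    ext ω
    simp
  rw [this]
  exact MeasurableSet.biUnion (Set.to_countable _) fun w _ => hX.measurable t w

/-! ### Laws that depend on the top level only -/

/-- On the event `E`, the law of the lower `n` levels at time `t` has a density that depends on
level `n` only, and this density is `k`. -/
def HasLevelLaw (μ : Measure Ω) (X : ℝ≥0 → Ω → GT N) {n : ℕ} (hn : n ≤ N) (t : ℝ≥0) (E : Set Ω)
    (k : Weyl n → ENNReal) : Prop :=
  ∀ z : GT n, μ (E ∩ {ω | (X t ω).proj n hn = z}) = k (z.level n le_rfl)

/-- The law on level `n` after a further time `t`. -/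
noncomputable def evolve {n : ℕ} (t : ℝ≥0) (k : Weyl n → ENNReal) (y : Weyl n) : ENNReal :=
  ∑' x : Weyl n, k x * ENNReal.ofReal (poissonDet t x.1 y.1)

open Classical in
/-- The law on level `n`, given that on level `n + 1`. -/
noncomputable def lower {n : ℕ} (k : Weyl (n + 1) → ENNReal) (x : Weyl n) : ENNReal :=
  ∑' y : Weyl (n + 1), if Interlaces x.1 y.1 then k y else 0

open Classical in
theorem tsum_level_eq {n : ℕ} (f : GT n → ENNReal) (k : Weyl n → ENNReal) :
    ∑' w : GT n, k (w.level n le_rfl) * f w = ∑' x : Weyl n, k x * levelSum f x.1 := by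
  have h : ∀ x : Weyl n, k x * levelSum f x.1 =
      ∑' w : GT n, if w.level n le_rfl = x then k x * f w else 0 := by
    intro x
    rw [levelSum, ← ENNReal.tsum_mul_left]
    refine tsum_congr fun w => ?_
    have : w.level n le_rfl = x ↔ w.top = x.1 := Subtype.ext_iff
    simp only [this]
    split_ifs <;> simp
  simp only [h]
  rw [ENNReal.tsum_comm]
  refine tsum_congr fun w => ?_
  rw [tsum_eq_single (w.level n le_rfl) (fun x hx => if_neg hx.symm), if_pos rfl]

/-- Since the mass at time t depends on the top level only, the transition probabilities get summed
over all patterns with a given top level, and `levelSum_transProb` makes the result blind to the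
lower levels of z. -/
theorem HasLevelLaw.evolve [IsProbabilityMeasure μ] (hX : IsPackedDynamics μ X) {n : ℕ} {hn : n ≤ N}
    {t t' : ℝ≥0} {E : Set Ω} {k : Weyl n → ENNReal} (hk : HasLevelLaw μ X hn t E k)
    (hE : PastEvent X E t) (h : t ≤ t') :
    HasLevelLaw μ X hn t' E (evolve (t' - t) k) := by
  classical
  intro z
  have h1 : ∀ z' : GT N, μ (E ∩ {ω | X t' ω = z'}) = ∑' w : GT N, μ (E ∩ {ω | X t ω = w}) *
      ENNReal.ofReal (transProb (t' - t) w z') := by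
    intro z'
    rw [measure_eq_tsum_fiber μ _ (hX.measurable t)]
    exact tsum_congr fun w => hE.measure_inter hX h w z'
  calc μ (E ∩ {ω | (X t' ω).proj n hn = z})
      = ∑' (z' : GT N) (w : GT N), if z'.proj n hn = z then μ (E ∩ {ω | X t ω = w}) *
          ENNReal.ofReal (transProb (t' - t) w z') else 0 := by
        rw [hX.measure_proj hn]
        refine tsum_congr fun z' => ?_
        split_ifs
        · exact h1 z'
        · simp
    -- The levels above n of the final state are summed out, as the lower levels evolve
    -- autonomously.
    _ = ∑' w : GT N, μ (E ∩ {ω | X t ω = w}) *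
          ENNReal.ofReal (transProb (t' - t) (w.proj n hn) z) := by
        rw [ENNReal.tsum_comm]
        refine tsum_congr fun w => ?_
        rw [← tsum_transProb_proj hn, ← ENNReal.tsum_mul_left]
        refine tsum_congr fun z' => ?_
        split_ifs <;> simp
    _ = ∑' w : GT n, μ (E ∩ {ω | (X t ω).proj n hn = w}) *
          ENNReal.ofReal (transProb (t' - t) w z) := by
        simp only [hX.measure_proj hn, ← ENNReal.tsum_mul_right]
        rw [ENNReal.tsum_comm]
        refine tsum_congr fun w => ?_
        rw [tsum_eq_single (w.proj n hn) (fun w' hw' => by rw [if_neg hw'.symm, zero_mul]),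
          if_pos rfl]
    _ = _ := by
        simp only [hk _]
        rw [tsum_level_eq]
        exact tsum_congr fun x => by rw [levelSum_transProb _ x.2]; rfl

-- The new condition concerns level n at the same time t, so it multiplies the density by an
-- indicator function of that level.
open Classical in
theorem HasLevelLaw.observe {n : ℕ} {hn : n ≤ N} {t : ℝ≥0} {E : Set Ω} {k : Weyl n → ENNReal}
    (hk : HasLevelLaw μ X hn t E k) (P : Weyl n → Prop) :
    HasLevelLaw μ X hn t (E ∩ {ω | P ((X t ω).level n hn)}) (fun x => if P x then k x else 0) := by
  intro z
  have hlev : ∀ ω, (X t ω).proj n hn = z → (X t ω).level n hn = z.level n le_rfl := by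
    rintro ω rfl
    rfl
  change _ = if P (z.level n le_rfl) then k (z.level n le_rfl) else 0
  split_ifs with hP
  · rw [← hk z]
    congr 1
    ext ω
    simp only [Set.mem_ofPred_eq, Set.mem_inter_iff]
    constructor
    · rintro ⟨⟨h1, -⟩, h2⟩
      exact ⟨h1, h2⟩
    · rintro ⟨h1, h2⟩
      exact ⟨⟨h1, by rw [hlev ω h2]; exact hP⟩, h2⟩
  · convert measure_empty (μ := μ)
    refine Set.eq_empty_of_forall_notMem ?_
    rintro ω ⟨⟨-, h1⟩, h2⟩
    rw [Set.mem_ofPred_eq, hlev ω h2] at h1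
    exact hP h1

/-- The patterns of height n + 1 above z arise by adding an interlacing level, and which levels may
be added depends on the top level of z only. -/
theorem HasLevelLaw.lower (hX : IsPackedDynamics μ X) {n : ℕ} {hn : n + 1 ≤ N} {t : ℝ≥0}
    {E : Set Ω} {k : Weyl (n + 1) → ENNReal} (hk : HasLevelLaw μ X hn t E k) :
    HasLevelLaw μ X (n.le_succ.trans hn) t E (lower k) := by
  classical
  intro z
  have h1 : μ (E ∩ {ω | (X t ω).proj n (n.le_succ.trans hn) = z}) =
      ∑' w : GT (n + 1), if w.proj n n.le_succ = z then k (w.level (n + 1) le_rfl) else 0 := by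
    rw [measure_eq_tsum_fiber μ _ (hX.measurableSet_proj hn t)]
    refine tsum_congr fun w => ?_
    split_ifs with hw
    · rw [← hk w]
      congr 1
      ext ω
      simp only [Set.mem_ofPred_eq, Set.mem_inter_iff]
      constructor
      · rintro ⟨⟨h1, -⟩, h2⟩
        exact ⟨h1, h2⟩
      · rintro ⟨h1, h2⟩
        refine ⟨⟨h1, ?_⟩, h2⟩
        rw [← hw, ← h2]
        rfl
    · convert measure_empty (μ := μ)
      refine Set.eq_empty_of_forall_notMem ?_
      rintro ω ⟨⟨-, h1⟩, h2⟩
      apply hw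
      rw [← (h2 : (X t ω).proj (n + 1) hn = w)]
      exact h1
  rw [h1]
  have h2 := tsum_GT_succ fun (z' : GT n) y =>
    if z' = z then if h : StrictMono y then k ⟨y, h⟩ else 0 else 0
  have h3 : ∀ w : GT (n + 1), (if w.proj n n.le_succ = z then
      if h : StrictMono w.top then k ⟨w.top, h⟩ else 0 else 0) =
      if w.proj n n.le_succ = z then k (w.level (n + 1) le_rfl) else 0 := by
    intro w
    rw [dif_pos w.strictMono_top]
    rfl
  simp only [h3] at h2
  rw [h2, tsum_eq_single z (fun z' hz' => by simp [hz'])]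
  have h4 := tsum_subtype {y : Fin (n + 1) → ℤ | StrictMono y} fun y =>
    if Interlaces z.top y then if h : StrictMono y then k ⟨y, h⟩ else 0 else 0
  have h5 : ∑' y : Fin (n + 1) → ℤ, Set.indicator {y : Fin (n + 1) → ℤ | StrictMono y} (fun y =>
      if Interlaces z.top y then if h : StrictMono y then k ⟨y, h⟩ else 0 else 0) y =
      ∑' y : Fin (n + 1) → ℤ, if Interlaces z.top y then if z = z then
        if h : StrictMono y then k ⟨y, h⟩ else 0 else 0 else 0 := by
    refine tsum_congr fun y => ?_
    by_cases hy : StrictMono y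
    · simp [hy]
    · simp [hy]
  rw [← h5, ← h4]
  refine tsum_congr fun y => ?_
  have hy : StrictMono y.1 := y.2
  rw [dif_pos hy]
  rfl

/-! ### The packed initial condition -/

/-- Between consecutive integers the condition y_k < x_k ≤ y_{k+1} has one solution, which is again
packed. -/
theorem eq_packed_of_top {n : ℕ} (z : GT n) (h : z.top = (packed n).top) : z = packed n := by
  induction n with
  | zero =>
    refine GT.ext_apply fun j k => ?_
    have h1 := j.isLt
    have h2 := k.isLt
    omega
  | succ n ih =>
    refine GT.eq_of_proj_of_top (ih _ ?_) h
    funext k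
    have h1 := z.interlaces_top k
    rw [h] at h1
    simp only [GT.top, packed, Fin.val_last, Fin.val_castSucc, Fin.val_succ] at h1 ⊢
    change _ = -(n : ℤ) - 1 + ((k : ℕ) + 1)
    push_cast at h1
    change _ < (z.proj n n.le_succ).top k ∧ (z.proj n n.le_succ).top k ≤ _ at h1
    change (z.proj n n.le_succ).top k = _
    omega

open Classical in
theorem IsPackedDynamics.hasLevelLaw_zero [IsProbabilityMeasure μ] (hX : IsPackedDynamics μ X)
    {n : ℕ} (hn : n ≤ N) :
    HasLevelLaw μ X hn 0 Set.univ
      (fun x => if x = (packed n).level n le_rfl then 1 else 0) := by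
  intro z
  rw [Set.univ_inter]
  change _ = if z.level n le_rfl = (packed n).level n le_rfl then 1 else 0
  by_cases hz : z = packed n
  · subst hz
    rw [if_pos rfl, ← measure_univ (μ := μ)]
    refine measure_congr (Filter.eventuallyEq_univ.2 ?_)
    filter_upwards [hX.initial] with ω hω
    rw [hω]
    rfl
  · have hne : z.level n le_rfl ≠ (packed n).level n le_rfl := fun h =>
      hz (eq_packed_of_top z (congrArg (fun x : Weyl n => x.1) h))
    rw [if_neg hne]
    refine measure_mono_null (t := {ω | ¬ X 0 ω = packed N}) (fun ω hω h => hz ?_) (ae_iff.1 hX.initial)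
    rw [← (hω : (X 0 ω).proj n hn = z), h]
    rfl

theorem IsPackedDynamics.hasLevelLaw [IsProbabilityMeasure μ] (hX : IsPackedDynamics μ X)
    {n : ℕ} (hn : n ≤ N) (t : ℝ≥0) :
    HasLevelLaw μ X hn t Set.univ
      (fun x => ENNReal.ofReal (poissonDet t (packed n).top x.1)) := by
  classical
  have h := (hX.hasLevelLaw_zero hn).evolve hX (pastEvent_univ X 0) (zero_le (a := t))
  convert h using 2 with x
  rw [evolve, tsum_eq_single ((packed n).level n le_rfl) (fun y hy => by
    rw [if_neg hy, zero_mul]), if_pos rfl, one_mul, tsub_zero]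
  rfl

end Dynamics

/-! ### Summation over the configurations -/

section Sums

variable {Ω : Type*} [MeasurableSpace Ω] {μ : Measure Ω} {N : ℕ} {X : ℝ≥0 → Ω → GT N}

open Classical in
/-- The weight of the time steps on one level, restricted to the event that the values satisfy
`P`. -/
noncomputable def stepWeight {n c : ℕ} (τ : Fin (c + 1) → ℝ≥0) (P : Fin c → Weyl n → Prop)
    (u : Fin (c + 1) → Weyl n) : ENNReal :=
  ∏ a : Fin c, (ENNReal.ofReal (poissonDet (τ a.succ - τ a.castSucc) (u a.castSucc).1 (u a.succ).1) *
    if P a (u a.succ) then 1 else 0)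

-- Alternates `evolve` and `observe`. The condition `P a` bears on the value with index a + 1: index
-- 0 is the auxiliary starting value of the level and is never observed.
open Classical in
theorem HasLevelLaw.chain [IsProbabilityMeasure μ] (hX : IsPackedDynamics μ X) {n c : ℕ}
    {hn : n ≤ N} {τ : Fin (c + 1) → ℝ≥0} (hτ : Monotone τ) (P : Fin c → Weyl n → Prop) {E : Set Ω}
    {k : Weyl n → ENNReal} (hE : PastEvent X E (τ 0)) (hk : HasLevelLaw μ X hn (τ 0) E k) :
    PastEvent X (E ∩ {ω | ∀ a, P a ((X (τ a.succ) ω).level n hn)}) (τ (Fin.last c)) ∧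
    HasLevelLaw μ X hn (τ (Fin.last c)) (E ∩ {ω | ∀ a, P a ((X (τ a.succ) ω).level n hn)})
      (fun x => ∑' u : Fin (c + 1) → Weyl n,
        if u (Fin.last c) = x then k (u 0) * stepWeight τ P u else 0) := by
  induction c generalizing E k with
  | zero =>
    have h1 : E ∩ {ω | ∀ a : Fin 0, P a ((X (τ a.succ) ω).level n hn)} = E := by
      ext ω
      simp
    rw [h1]
    refine ⟨hE, ?_⟩
    change HasLevelLaw μ X hn (τ 0) E _
    convert hk using 1
    funext x
    rw [tsum_eq_single (fun _ => x : Fin 1 → Weyl n), if_pos rfl]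
    · simp [stepWeight]
    · intro u hu
      refine if_neg fun h => hu ?_
      funext i
      rw [← h, Subsingleton.elim i (Fin.last 0)]
  | succ c ih =>
    have h01 : τ 0 ≤ τ (0 : Fin (c + 1)).succ := hτ (Fin.zero_le _)
    have hE1 := hE.inter h01 {x | P 0 (x.level n hn)}
    have hk1 := (hk.evolve hX hE h01).observe (P 0)
    have h2 := ih (τ := fun i => τ i.succ) (fun i j hij => hτ (Fin.succ_le_succ_iff.2 hij))
      (fun a => P a.succ) hE1 hk1
    have hEE : E ∩ {ω | P 0 ((X (τ (0 : Fin (c + 1)).succ) ω).level n hn)} ∩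
        {ω | ∀ a : Fin c, P a.succ ((X (τ a.succ.succ) ω).level n hn)} =
        E ∩ {ω | ∀ a, P a ((X (τ a.succ) ω).level n hn)} := by
      ext ω
      simp only [Set.mem_ofPred_eq, Set.mem_inter_iff, Fin.forall_fin_succ, and_assoc]
    change PastEvent X (E ∩ {ω | P 0 ((X (τ (0 : Fin (c + 1)).succ) ω).level n hn)} ∩
      {ω | ∀ a : Fin c, P a.succ ((X (τ a.succ.succ) ω).level n hn)}) (τ (Fin.last c).succ) ∧
      HasLevelLaw μ X hn (τ (Fin.last c).succ)
        (E ∩ {ω | P 0 ((X (τ (0 : Fin (c + 1)).succ) ω).level n hn)} ∩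
        {ω | ∀ a : Fin c, P a.succ ((X (τ a.succ.succ) ω).level n hn)}) _ at h2
    rw [hEE, Fin.succ_last] at h2
    refine ⟨h2.1, ?_⟩
    convert h2.2 using 1
    funext x
    -- The sum over the value at time τ 0 is singled out; it is the sum in the first `evolve`.
    rw [← (Fin.consEquiv fun _ : Fin (c + 2) => Weyl n).tsum_eq, ENNReal.tsum_prod', ENNReal.tsum_comm]
    refine tsum_congr fun u => ?_
    have hstep : ∀ x0 : Weyl n, stepWeight τ P ((Fin.consEquiv fun _ : Fin (c + 2) => Weyl n) (x0, u)) =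
        ENNReal.ofReal (poissonDet (τ (0 : Fin (c + 1)).succ - τ 0) x0.1 (u 0).1) *
          (if P 0 (u 0) then 1 else 0) *
          stepWeight (fun i => τ i.succ) (fun a => P a.succ) u := by
      intro x0
      unfold stepWeight
      rw [Fin.prod_univ_succ]
      rfl
    have hlast : ∀ x0 : Weyl n, (Fin.consEquiv fun _ : Fin (c + 2) => Weyl n) (x0, u)
        (Fin.last (c + 1)) = u (Fin.last c) := fun x0 => rfl
    have hfirst : ∀ x0 : Weyl n, (Fin.consEquiv fun _ : Fin (c + 2) => Weyl n) (x0, u) 0 = x0 :=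
      fun x0 => rfl
    simp only [hstep, hlast, hfirst]
    split_ifs with hx hP
    · rw [GTDynamics.evolve, ← ENNReal.tsum_mul_right]
      refine tsum_congr fun x0 => ?_
      rw [mul_one, mul_assoc]
    · simp
    · simp

open Classical in
/-- The weight of the transition from level `n` to level `n + 1` and of the time steps on level
`n + 1`. -/
noncomputable def levelWeight {c : ℕ → ℕ} (T : (n : ℕ) → Fin (c n + 1) → ℝ≥0)
    (P : (n : ℕ) → Fin (c n) → Weyl n → Prop) (n : ℕ) (x : Fin (c n + 1) → Weyl n)
    (y : Fin (c (n + 1) + 1) → Weyl (n + 1)) : ENNReal :=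
  (if Interlaces (x 0).1 (y (Fin.last _)).1 then 1 else 0) * stepWeight (T (n + 1)) (P (n + 1)) y

open Classical in
theorem lower_chain {c n : ℕ} (F : (Fin (c + 1) → Weyl (n + 1)) → ENNReal) (x : Weyl n) :
    lower (fun y => ∑' u, if u (Fin.last c) = y then F u else 0) x =
      ∑' u, (if Interlaces x.1 (u (Fin.last c)).1 then 1 else 0) * F u := by
  unfold lower
  have h : ∀ y : Weyl (n + 1), (if Interlaces x.1 y.1 then
      ∑' u, if u (Fin.last c) = y then F u else 0 else 0) =
      ∑' u : Fin (c + 1) → Weyl (n + 1),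
        if u (Fin.last c) = y then (if Interlaces x.1 y.1 then F u else 0) else 0 := by
    intro y
    split_ifs <;> simp
  simp only [h]
  rw [ENNReal.tsum_comm]
  refine tsum_congr fun u => ?_
  rw [tsum_eq_single (u (Fin.last c)) (fun y hy => if_neg hy.symm), if_pos rfl]
  split_ifs <;> simp

instance : Subsingleton (GT 0) :=
  ⟨fun _ _ => GT.ext_apply fun n k => by
    have h1 := n.isLt
    have h2 := k.isLt
    omega⟩

instance : Unique (Weyl 0) where
  default := ⟨fun k => k.elim0, fun k => k.elim0⟩
  uniq _ := Subtype.ext (funext fun k => k.elim0)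

/-- The sum over all configurations on the levels up to `L` of their weights is a probability. -/
theorem tsum_config [IsProbabilityMeasure μ] (hX : IsPackedDynamics μ X) {c : ℕ → ℕ}
    (T : (n : ℕ) → Fin (c n + 1) → ℝ≥0) (hT : ∀ n, Monotone (T n))
    (P : (n : ℕ) → Fin (c n) → Weyl n → Prop) {L : ℕ} (hL : L ≤ N)
    (hlink : ∀ n < L, T n 0 = T (n + 1) (Fin.last _)) {E : Set Ω} {k : Weyl L → ENNReal}
    (hE : PastEvent X E (T L 0)) (hk : HasLevelLaw μ X hL (T L 0) E k) :
    ∑' z : (n : Fin (L + 1)) → Fin (c n + 1) → Weyl n, k (z (Fin.last L) 0) *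
      ∏ l : Fin L, levelWeight T P l (z l.castSucc) (z l.succ) =
    μ (E ∩ {ω | ∀ (l : Fin L) (a : Fin (c (l + 1))),
      P (l + 1) a ((X (T (l + 1) a.succ) ω).level (l + 1) (by omega))}) := by
  classical
  -- Levels are removed from the top: the observations on level L + 1 are absorbed into the event
  -- and the density before the descent to level L.
  induction L generalizing E with
  | zero =>
    have hsub : ∀ n : Fin 1, Subsingleton (Weyl n) := fun n =>
      ⟨fun x y => Subtype.ext (funext fun i => by have := n.isLt; have := i.isLt; omega)⟩
    let z0 : (n : Fin 1) → Fin (c n + 1) → Weyl n := fun n _ =>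
      ⟨fun i => by have := n.isLt; have := i.isLt; omega,
        fun i => by have := n.isLt; have := i.isLt; omega⟩
    rw [tsum_eq_single z0 fun z hz => absurd (Subsingleton.elim z z0) hz]
    have h1 : E ∩ {ω | ∀ (l : Fin 0) (a : Fin (c (l + 1))),
        P (l + 1) a ((X (T (l + 1) a.succ) ω).level (l + 1) (by omega))} =
        E ∩ {ω | (X (T 0 0) ω).proj 0 hL = packed 0} := by
      congr 1
      ext ω
      simp [eq_iff_true_of_subsingleton]
    rw [h1, hk]
    simp only [Finset.univ_eq_empty, Finset.prod_empty, mul_one]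
    congr 1
    exact Subsingleton.elim (α := Weyl 0) _ _
  | succ L ih =>
    obtain ⟨hE1, hk1⟩ := hk.chain hX (hT (L + 1)) (P (L + 1)) hE
    -- The descent happens at a fixed time, the last one of level L + 1 being the initial one of
    -- level L.
    rw [← hlink L L.lt_succ_self] at hE1 hk1
    have h2 := ih (L.le_succ.trans hL) (fun n hn => hlink n (hn.trans L.lt_succ_self)) hE1
      (hk1.lower hX)
    have hEE : E ∩ {ω | ∀ a, P (L + 1) a ((X (T (L + 1) a.succ) ω).level (L + 1) hL)} ∩
        {ω | ∀ (l : Fin L) (a : Fin (c (l + 1))),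
          P (l + 1) a ((X (T (l + 1) a.succ) ω).level (l + 1) (by omega))} =
        E ∩ {ω | ∀ (l : Fin (L + 1)) (a : Fin (c (l + 1))),
          P (l + 1) a ((X (T (l + 1) a.succ) ω).level (l + 1) (by omega))} := by
      ext ω
      simp only [Set.mem_ofPred_eq, Set.mem_inter_iff, Fin.forall_fin_succ' (n := L), and_assoc]
      exact and_congr_right fun _ => and_comm
    rw [hEE] at h2
    rw [← h2, ← (Fin.snocEquiv fun n : Fin (L + 2) => Fin (c n + 1) → Weyl n).tsum_eq,
      ENNReal.tsum_prod', ENNReal.tsum_comm]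
    refine tsum_congr fun z => ?_
    rw [lower_chain, ← ENNReal.tsum_mul_right]
    refine tsum_congr fun u => ?_
    have hlast : (Fin.snocEquiv fun n : Fin (L + 2) => Fin (c n + 1) → Weyl n) (u, z)
        (Fin.last (L + 1)) = u :=
      Fin.snoc_last (α := fun n : Fin (L + 2) => Fin (c n + 1) → Weyl n) u z
    have hcast : ∀ i : Fin (L + 1), (Fin.snocEquiv fun n : Fin (L + 2) => Fin (c n + 1) → Weyl n)
        (u, z) i.castSucc = z i := fun i =>
      Fin.snoc_castSucc (α := fun n : Fin (L + 2) => Fin (c n + 1) → Weyl n) u z i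
    rw [Fin.prod_univ_castSucc, hlast]
    have hprod : ∏ l : Fin L, levelWeight T P l.castSucc
        ((Fin.snocEquiv fun n : Fin (L + 2) => Fin (c n + 1) → Weyl n) (u, z) l.castSucc.castSucc)
        ((Fin.snocEquiv fun n : Fin (L + 2) => Fin (c n + 1) → Weyl n) (u, z) l.castSucc.succ) =
        ∏ l : Fin L, levelWeight T P l (z l.castSucc) (z l.succ) := by
      refine Finset.prod_congr rfl fun l _ => ?_
      have h4 := hcast l.succ
      have h5 := hcast l.castSucc
      exact congrArg₂ (levelWeight T P l) h5 h4
    have htop : levelWeight T P (Fin.last L : Fin (L + 1))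
        ((Fin.snocEquiv fun n : Fin (L + 2) => Fin (c n + 1) → Weyl n) (u, z) (Fin.last L).castSucc)
        ((Fin.snocEquiv fun n : Fin (L + 2) => Fin (c n + 1) → Weyl n) (u, z) (Fin.last L).succ) =
        levelWeight T P L (z (Fin.last L)) u :=
      congrArg₂ (levelWeight T P L) (hcast (Fin.last L)) hlast
    rw [hprod, htop, levelWeight]
    ring

end Sums

/-! ### Space-like points -/

/-- If i is in S, then S contains all indices up to i; otherwise S lies strictly below i. Comparing
cardinalities decides. -/
theorem mem_iff_lt_card_of_isLowerSet {m : ℕ} {S : Finset (Fin m)}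
    (hS : ∀ i j, j ≤ i → i ∈ S → j ∈ S) (i : Fin m) : i ∈ S ↔ (i : ℕ) < S.card := by
  constructor
  · intro hi
    have h := Finset.card_le_card (s := Finset.Iic i) (t := S) fun j hj =>
      hS i j (Finset.mem_Iic.1 hj) hi
    rw [Fin.card_Iic] at h
    omega
  · intro hi
    by_contra hn
    have h := Finset.card_le_card (s := S) (t := Finset.Iio i) fun j hj => by
      rw [Finset.mem_Iio]
      by_contra hij
      exact hn (hS j i (not_lt.1 hij) hj)
    rw [Fin.card_Iio] at h
    omega

section Levels

variable {m : ℕ} {lev : Fin m → ℕ} (hlev : Antitone lev)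

include hlev in
theorem lt_lev_iff (n : ℕ) (i : Fin m) : n < lev i ↔ (i : ℕ) < numAbove lev n := by
  have h := mem_iff_lt_card_of_isLowerSet (S := Finset.univ.filter fun i => n < lev i)
    (fun i j hij hi => by
      simp only [Finset.mem_filter, Finset.mem_univ, true_and] at hi ⊢
      exact hi.trans_le (hlev hij)) i
  simpa [numAbove] using h

theorem numAbove_eq_add (lev : Fin m → ℕ) (n : ℕ) :
    numAbove lev n = numAbove lev (n + 1) + numAt lev (n + 1) := by
  unfold numAbove numAt
  rw [← Finset.card_union_of_disjoint]
  · congr 1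
    ext i
    simp only [Finset.mem_filter, Finset.mem_univ, true_and, Finset.mem_union]
    omega
  · rw [Finset.disjoint_filter]
    intro i _ h
    omega

-- Levels decrease along the list, so the i + 1 points up to i are those on higher levels and those
-- on the same level that do not come later.
include hlev in
theorem numAbove_add_rankAt (i : Fin m) :
    numAbove lev (lev i) + (rankAt lev i : ℕ) = i + 1 := by
  have h : numAbove lev (lev i) + (rankAt lev i : ℕ) = (Finset.Iic i).card := by
    unfold numAbove rankAt
    simp only
    rw [← Finset.card_union_of_disjoint]
    · congr 1
      ext j
      simp only [Finset.mem_filter, Finset.mem_univ, true_and, Finset.mem_union, Finset.mem_Iic]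
      constructor
      · rintro (h | h)
        · by_contra hij
          exact absurd (hlev (not_le.1 hij).le) (by omega)
        · exact h.1
      · intro h
        have := hlev h
        rcases this.lt_or_eq with h1 | h1
        · exact Or.inl h1
        · exact Or.inr ⟨h, h1.symm⟩
    · rw [Finset.disjoint_filter]
      intro j _ h
      omega
  rw [h, Fin.card_Iic]

include hlev in
theorem rankAt_ne_zero (i : Fin m) : (rankAt lev i : ℕ) ≠ 0 := by
  intro h0
  have h1 := numAbove_add_rankAt hlev i
  have h2 := (lt_lev_iff hlev (lev i) i).2 (by omega)
  omega

variable [NeZero m] {tm : Fin m → ℝ≥0}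

include hlev in
theorem levelTime_rankAt (i : Fin m) (n : ℕ) (a : Fin (numAt lev n + 1)) (h : lev i = n)
    (ha : (rankAt lev i : ℕ) = a) (ha0 : (a : ℕ) ≠ 0) : levelTime lev tm n a = tm i := by
  unfold levelTime
  rw [if_neg (by omega)]
  congr 1
  have h1 := numAbove_add_rankAt hlev i
  have h2 : numAbove lev (lev i) = numAbove lev n := by rw [h]
  exact Fin.ext (by simp only; omega)

theorem monotone_levelTime (lev : Fin m → ℕ) (htm : Monotone tm) (n : ℕ) :
    Monotone (levelTime lev tm n) := by
  intro a b hab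
  have h : (a : ℕ) ≤ b := hab
  unfold levelTime
  split_ifs with h1 h2 h2
  · exact le_rfl
  · exact htm (Fin.zero_le _)
  · exact absurd ⟨by omega, h2.2⟩ h1
  · exact htm (by rw [Fin.mk_le_mk]; omega)

-- Both sides are the time of the last point above level n. Such a point exists because n < lev 0,
-- so the default branch of `levelTime` is not reached.
include hlev in
theorem levelTime_zero_eq_last {n : ℕ} (hn : n < lev 0) :
    levelTime lev tm n 0 = levelTime lev tm (n + 1) (Fin.last _) := by
  have h1 := numAbove_eq_add lev n
  have h2 := (lt_lev_iff hlev n 0).1 hn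
  have h3 : ((0 : Fin (numAt lev n + 1)) : ℕ) = 0 := rfl
  unfold levelTime
  rw [if_neg (by simp only [Fin.val_zero] at h2; omega),
    if_neg (by simp only [Fin.val_zero, Fin.val_last] at h2 ⊢; omega)]
  congr 1
  exact Fin.ext (by simp only [Fin.val_last]; omega)

include hlev in
theorem levelTime_top_zero : levelTime lev tm (lev 0) 0 = tm 0 := by
  unfold levelTime
  refine if_pos ⟨rfl, ?_⟩
  unfold numAbove
  rw [Finset.card_eq_zero, Finset.filter_eq_empty_iff]
  exact fun i _ => not_lt.2 (hlev (Fin.zero_le i))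

/-- The condition that the conditions `Q` on the observed points impose on the value with index
`a + 1` on level `n`. -/
def levelCondition (Q : (i : Fin m) → Weyl (lev i) → Prop) (n : ℕ) (a : Fin (numAt lev n))
    (x : Weyl n) : Prop :=
  ∀ (i : Fin m) (h : n = lev i), (rankAt lev i : ℕ) = a + 1 → Q i (h ▸ x)

-- Levels and ranks of the points are positive, so each point is met by a pair (l + 1, a + 1). The
-- family `x` is abstract in order to serve both for the process and for configurations.
include hlev in
theorem forall_levelCondition_iff (hpos : ∀ i, 1 ≤ lev i)
    (Q : (i : Fin m) → Weyl (lev i) → Prop)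
    (x : (n : ℕ) → n ≤ lev 0 → Fin (numAt lev n + 1) → Weyl n) :
    (∀ (l : Fin (lev 0)) (a : Fin (numAt lev (l + 1))),
      levelCondition Q (l + 1) a (x (l + 1) l.isLt a.succ)) ↔
    ∀ i, Q i (x (lev i) (hlev (Fin.zero_le i)) (rankAt lev i)) := by
  have hcast : ∀ (n : ℕ) (hn : n ≤ lev 0) (a : Fin (numAt lev n + 1)) (i : Fin m) (h : n = lev i),
      (rankAt lev i : ℕ) = a → (h ▸ x n hn a : Weyl (lev i)) =
        x (lev i) (hlev (Fin.zero_le i)) (rankAt lev i) := by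
    intro n hn a i h ha
    subst h
    rw [Fin.ext ha]
  constructor
  · intro h i
    have h1 : lev i = (lev i - 1) + 1 := by have := hpos i; omega
    have h2 := hlev (Fin.zero_le i)
    have h3 := rankAt_ne_zero hlev i
    have h4 := (rankAt lev i).isLt
    have h5 : numAt lev (lev i) = numAt lev (lev i - 1 + 1) := by rw [← h1]
    have h6 := h ⟨lev i - 1, by omega⟩ ⟨(rankAt lev i : ℕ) - 1, by simp only; omega⟩ i h1.symm
      (by simp only; omega)
    rwa [hcast _ _ _ _ _ (by simp only [Fin.val_succ]; omega)] at h6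
  · intro h l a i hi hr
    rw [hcast _ _ _ _ _ (by simpa using hr)]
    exact h i

end Levels

/-! ### Signs, constants and the return to real sums -/

theorem hasSum_of_tsum_ofReal {ι : Type*} {f : ι → ℝ} (hf : ∀ i, 0 ≤ f i) {v : ENNReal}
    (hv : v ≠ ⊤) (h : ∑' i, ENNReal.ofReal (f i) = v) : HasSum f v.toReal := by
  have h1 := ENNReal.hasSum_toReal (f := fun i => ENNReal.ofReal (f i)) (by rw [h]; exact hv)
  rw [← ENNReal.tsum_toReal_eq (fun i => ENNReal.ofReal_ne_top), h] at h1
  simpa [ENNReal.toReal_ofReal (hf _)] using h1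

/-- The factor of the weight that belongs to level `n + 1`, with the sign that makes it
non-negative. -/
noncomputable def levelFactor {c : ℕ → ℕ} (T : (n : ℕ) → Fin (c n + 1) → ℝ≥0) (n : ℕ)
    (x : Fin (c n + 1) → Weyl n) (y : Fin (c (n + 1) + 1) → Weyl (n + 1)) : ℝ :=
  (-1) ^ n * (phiDet (x 0).1 (y (Fin.last _)).1 * ∏ a : Fin (c (n + 1)),
    poissonDet (T (n + 1) a.succ - T (n + 1) a.castSucc) (y a.castSucc).1 (y a.succ).1)

section LevelFactor

variable {c : ℕ → ℕ} (T : (n : ℕ) → Fin (c n + 1) → ℝ≥0) {n : ℕ} (x : Fin (c n + 1) → Weyl n)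
  (y : Fin (c (n + 1) + 1) → Weyl (n + 1))

open Classical in
theorem levelFactor_eq : levelFactor T n x y =
    (if Interlaces (x 0).1 (y (Fin.last _)).1 then 1 else 0) * ∏ a : Fin (c (n + 1)),
      poissonDet (T (n + 1) a.succ - T (n + 1) a.castSucc) (y a.castSucc).1 (y a.succ).1 := by
  rw [levelFactor, ← mul_assoc, neg_one_pow_mul_phiDet (x 0).2 (y (Fin.last _)).2]

theorem levelFactor_nonneg : 0 ≤ levelFactor T n x y := by
  classical
  rw [levelFactor_eq]
  exact mul_nonneg (by split_ifs <;> simp) (Finset.prod_nonneg fun a _ =>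
    poissonDet_nonneg _ (y a.castSucc).2 (y a.succ).2)

open Classical in
theorem levelWeight_eq (P : (n : ℕ) → Fin (c n) → Weyl n → Prop) :
    levelWeight T P n x y = ENNReal.ofReal (levelFactor T n x y) *
      if ∀ a, P (n + 1) a (y a.succ) then 1 else 0 := by
  rw [levelFactor_eq, ENNReal.ofReal_mul (by split_ifs <;> simp),
    ENNReal.ofReal_prod_of_nonneg fun a _ => poissonDet_nonneg _ (y a.castSucc).2 (y a.succ).2,
    levelWeight, stepWeight, Finset.prod_mul_distrib, Finset.prod_ite_zero]
  simp only [Finset.mem_univ, true_imp_iff, Finset.prod_const_one]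
  rw [mul_assoc]
  congr 1
  split_ifs <;> simp

end LevelFactor

open Classical in
/-- Up to a constant, the weight of a configuration is the product of the law on the top level and
of the weights of the levels. -/
theorem exists_const_mul_weight {m : ℕ} [NeZero m] (lev : Fin m → ℕ) (tm : Fin m → ℝ≥0)
    (ht : 0 < tm 0) :
    ∃ C : ℝ, ∀ z : Config lev, 0 ≤ C * weight lev tm z ∧
      ∀ P : (n : ℕ) → Fin (numAt lev n) → Weyl n → Prop,
        (if ∀ (l : Fin (lev 0)) (a : Fin (numAt lev (l + 1))), P (l + 1) a (z l.succ a.succ) then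
          ENNReal.ofReal (C * weight lev tm z) else 0) =
        ENNReal.ofReal (poissonDet (tm 0) (packed (lev 0)).top (z (Fin.last _) 0).1) *
          ∏ l : Fin (lev 0), levelWeight (c := numAt lev) (levelTime lev tm) P l
            (z l.castSucc) (z l.succ) := by
  obtain ⟨κ, hκ⟩ := poissonDet_packed (lev 0) ht
  have hpk : (packed (lev 0)).top = fun i : Fin (lev 0) => -(lev 0 : ℤ) + (i : ℕ) := by
    funext i
    change -(lev 0 : ℤ) - 1 + ((i : ℕ) + 1) = _
    ring
  -- κ normalizes the Charlier density, and the signs turn the determinants of φ into indicators.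
  refine ⟨κ * ∏ l : Fin (lev 0), (-1) ^ (l : ℕ), fun z => ?_⟩
  have hw : κ * (∏ l : Fin (lev 0), (-1) ^ (l : ℕ)) * weight lev tm z =
      poissonDet (tm 0) (packed (lev 0)).top (z (Fin.last _) 0).1 * ∏ l : Fin (lev 0),
        levelFactor (c := numAt lev) (levelTime lev tm) l (z l.castSucc) (z l.succ) := by
    have h1 : ∏ l : Fin (lev 0),
        levelFactor (c := numAt lev) (levelTime lev tm) l (z l.castSucc) (z l.succ) =
        (∏ l : Fin (lev 0), (-1) ^ (l : ℕ)) * ∏ l : Fin (lev 0),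
          (phiDet (l := (l : ℕ)) (z l.castSucc 0) (z l.succ (Fin.last _)) *
            ∏ a : Fin (numAt lev (l.succ : Fin (lev 0 + 1))),
              poissonDet (levelTime lev tm _ a.succ - levelTime lev tm _ a.castSucc)
                (z l.succ a.castSucc) (z l.succ a.succ)) := by
      rw [← Finset.prod_mul_distrib]
      rfl
    have h2 : poissonDet (tm 0) (packed (lev 0)).top (z (Fin.last _) 0).1 =
        κ * (vandermonde (z (Fin.last _) 0) *
          ∏ i : Fin (lev 0), poissonWeight (tm 0) (z (Fin.last _) 0 i + (lev 0 : ℤ))) := by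
      rw [hpk]
      exact hκ (z (Fin.last _) 0).1
    rw [h1, h2, weight]
    ring
  have h0 : 0 ≤ poissonDet (tm 0) (packed (lev 0)).top (z (Fin.last _) 0).1 :=
    poissonDet_nonneg _ (packed (lev 0)).strictMono_top (z (Fin.last _) 0).2
  have h1 : ∀ l : Fin (lev 0), 0 ≤
      levelFactor (c := numAt lev) (levelTime lev tm) l (z l.castSucc) (z l.succ) :=
    fun l => levelFactor_nonneg (c := numAt lev) (levelTime lev tm) (z l.castSucc) (z l.succ)
  rw [hw]
  refine ⟨mul_nonneg h0 (Finset.prod_nonneg fun l _ => h1 l), fun P => ?_⟩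
  have h2 : ∀ l : Fin (lev 0), levelWeight (c := numAt lev) (levelTime lev tm) P l
      (z l.castSucc) (z l.succ) = ENNReal.ofReal
        (levelFactor (c := numAt lev) (levelTime lev tm) l (z l.castSucc) (z l.succ)) *
      if ∀ a : Fin (numAt lev (l + 1)), P (l + 1) a (z l.succ a.succ) then 1 else 0 :=
    fun l => levelWeight_eq (c := numAt lev) (levelTime lev tm) (z l.castSucc) (z l.succ) P
  rw [Finset.prod_congr rfl fun l _ => h2 l, Finset.prod_mul_distrib, Finset.prod_ite_zero,
    ENNReal.ofReal_mul h0, ENNReal.ofReal_prod_of_nonneg fun l _ => h1 l]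
  simp only [Finset.mem_univ, true_imp_iff, Finset.prod_const_one]
  split_ifs <;> simp

end GTDynamics

open GTDynamics in
theorem mainTheorem4 {Ω : Type*} [MeasurableSpace Ω] (μ : Measure Ω) [IsProbabilityMeasure μ]
    (N : ℕ) (X : ℝ≥0 → Ω → GT N) (hX : IsPackedDynamics μ X)
    (m : ℕ) [NeZero m] (lev : Fin m → ℕ) (tm : Fin m → ℝ≥0)
    (hpos : ∀ i, 1 ≤ lev i) (hN : lev 0 ≤ N) (ht : 0 < tm 0)
    (hsl : ∀ i j, i < j → SpaceLike (lev i, tm i) (lev j, tm j)) :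
    ∃ C : ℝ,
      (∀ z : Config lev, 0 ≤ C * weight lev tm z) ∧
      HasSum (fun z : Config lev => C * weight lev tm z) 1 ∧
      ∀ y : (i : Fin m) → Weyl (lev i),
        HasSum
          (Set.indicator {z : Config lev | ∀ i, observed lev (SpaceLike.level_le_top hsl) z i = y i}
            (fun z => C * weight lev tm z))
          (μ.real {ω | ∀ i, (X (tm i) ω).level (lev i) ((SpaceLike.level_le_top hsl i).trans hN) = y i}) := by
  classical
  have hlev : Antitone lev := fun i j hij => by
    rcases hij.lt_or_eq with h | rfl
    · exact (hsl i j h).1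
    · exact le_rfl
  have htm : Monotone tm := fun i j hij => by
    rcases hij.lt_or_eq with h | rfl
    · exact (hsl i j h).2.1
    · exact le_rfl
  obtain ⟨C, hC⟩ := exists_const_mul_weight lev tm ht
  -- A trivial Q will give the total mass, and Q i = (· = y i) the marginal.
  have key : ∀ Q : (i : Fin m) → Weyl (lev i) → Prop,
      ∑' z : Config lev, ENNReal.ofReal (Set.indicator
        {z : Config lev | ∀ i, Q i (observed lev (SpaceLike.level_le_top hsl) z i)}
        (fun z => C * weight lev tm z) z) =
      μ {ω | ∀ i, Q i ((X (tm i) ω).level (lev i) ((SpaceLike.level_le_top hsl i).trans hN))} := by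
    intro Q
    have h1 := tsum_config hX (levelTime lev tm) (monotone_levelTime lev htm) (levelCondition Q) hN
      (fun n hn => levelTime_zero_eq_last hlev hn) (pastEvent_univ X _)
      (hX.hasLevelLaw hN (levelTime lev tm (lev 0) 0))
    -- On the top level t_0 = t_1, so the initial density is the Poisson determinant at the first
    -- observation time.
    rw [levelTime_top_zero hlev] at h1
    simp only [← (hC _).2] at h1
    have h2 : ∀ ω, (∀ (l : Fin (lev 0)) (a : Fin (numAt lev (l + 1))), levelCondition Q (l + 1) a
        ((X (levelTime lev tm (l + 1) a.succ) ω).level (l + 1) (l.isLt.trans_le hN))) ↔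
        ∀ i, Q i ((X (tm i) ω).level (lev i) ((SpaceLike.level_le_top hsl i).trans hN)) := by
      intro ω
      rw [forall_levelCondition_iff hlev hpos Q fun n hn a =>
        (X (levelTime lev tm n a) ω).level n (hn.trans hN)]
      refine forall_congr' fun i => ?_
      rw [levelTime_rankAt hlev i (lev i) (rankAt lev i) rfl rfl (rankAt_ne_zero hlev i)]
    have h3 : ∀ z : Config lev, (∀ (l : Fin (lev 0)) (a : Fin (numAt lev (l + 1))),
        levelCondition Q (l + 1) a (z l.succ a.succ)) ↔
        ∀ i, Q i (observed lev (SpaceLike.level_le_top hsl) z i) := fun z =>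
      forall_levelCondition_iff hlev hpos Q fun n hn a => z ⟨n, Nat.lt_succ_of_le hn⟩ a
    simp only [h2, h3, Set.univ_inter] at h1
    rw [← h1]
    refine tsum_congr fun z => ?_
    simp only [Set.indicator_apply, Set.mem_ofPred_eq]
    split_ifs <;> simp
  refine ⟨C, fun z => (hC z).1, ?_, fun y => ?_⟩
  · have h1 := hasSum_of_tsum_ofReal (fun z => Set.indicator_nonneg (fun z _ => (hC z).1) z)
      (measure_ne_top μ _) (key fun _ _ => True)
    simpa using h1
  · exact hasSum_of_tsum_ofReal (fun z => Set.indicator_nonneg (fun z _ => (hC z).1) z)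
      (measure_ne_top μ _) (key fun i x => x = y i)
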